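/- Let $K$ be a field and $A=K[X_1,\dots,X_n]$ with the standard grading and $\mathfrak m=(X_1,\dots,X_n)$. Let $F=\bigoplus_{j=1}^m A e_j$ be a graded free $A$-module with $\deg e_j=d_j\in\mathbb Z$, and let $\omega\in\mathbb Z_{\ge 0}^n$ and $\epsilon\in\mathbb Z_{\ge 0}^m$ be weight vectors. The monomial $X^{u}e_j$ has weight $\omega\cdot u+\epsilon_j$. For $0\neq f\in F$, let $\operatorname{in}_{(\omega,\epsilon)}(f)$ be the sum, with coefficients, of the monomials of $f$ of largest weight. For a submodule $M\subseteq F$, let $\operatorname{in}_{(\omega,\epsilon)}(M)$ be the submodule of $F$ generated by all $\operatorname{in}_{(\omega,\epsilon)}(f)$ with $0\ne f\in M$. For a graded submodule $N\subseteq F$, let $\beta_i(N)$ be the rank, and $\beta_{i,j}(N)$ the number of basis elements of degree $j$, of the $i$-th free module in a minimal graded free resolution of $N$ over $A$. Let $\operatorname{reg}(N)=\sup\{j-i : \beta_{i,j}(N)\neq 0\}$, with $\operatorname{reg}(0)=-\infty$. Call $N$ componentwise linear if $\operatorname{reg}(N_{\langle a\rangle})\le a$ for all $a\in\mathbb Z$,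 where $N_{\langle a\rangle}$ is the submodule generated by the degree $a$ component $N_a$ of $N$. Let $M\subseteq F$ be a graded submodule such that $\operatorname{in}_{(\omega,\epsilon)}(M)$ is componentwise linear. If $\beta_1(M)=\beta_1(\operatorname{in}_{(\omega,\epsilon)}(M))$, then $M$ is componentwise linear. -/

import Mathlib

namespace GradedFree

open MvPolynomial

/-- The free module `F = A e_1 ⊕ ⋯ ⊕ A e_m` over `A = K[X_1, …, X_n]`. -/
abbrev FreeMod (K : Type*) [Field K] (n m : ℕ) : Type _ :=
  Fin m → MvPolynomial (Fin n) K

section Grading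

variable {K : Type*} [Field K] {n m : ℕ}

/-- The homogeneous component `F_a` of `F = ⨁ A(-d_j)`, where `e_j` has degree `d_j`: the monomial
`X^u e_j` has degree `|u| + d_j`. -/
noncomputable def degreePart (d : Fin m → ℤ) (a : ℤ) : Submodule K (FreeMod K n m) where
  carrier := {f | ∀ j u, coeff u (f j) ≠ 0 → (u.degree : ℤ) + d j = a}
  zero_mem' := fun j u h => absurd (by simp) h
  add_mem' := by
    intro f g hf hg j u h
    by_cases hfu : coeff u (f j) = 0
    · refine hg j u fun hgu => h ?_
      simp [hfu, hgu]
    · exact hf j u hfu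
  smul_mem' := by
    intro c f hf j u h
    refine hf j u fun hfu => h ?_
    simp [hfu]

/-- The degree `a` component `M_a = M ∩ F_a` of a submodule `M` of `F`. -/
noncomputable def gradedPiece (d : Fin m → ℤ) (M : Submodule (MvPolynomial (Fin n) K) (FreeMod K n m))
    (a : ℤ) : Submodule K (FreeMod K n m) :=
  M.restrictScalars K ⊓ degreePart d a

/-- `M` is a graded submodule of `F`: it is the sum of its components `M_a`
(the sum is automatically direct). -/
def IsGraded (d : Fin m → ℤ) (M : Submodule (MvPolynomial (Fin n) K) (FreeMod K n m)) : Prop :=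
  ⨆ a, gradedPiece d M a = M.restrictScalars K

/-- The submodule `M_⟨a⟩` of `M` generated by `M_a`. -/
noncomputable def generatedInDegree (d : Fin m → ℤ)
    (M : Submodule (MvPolynomial (Fin n) K) (FreeMod K n m)) (a : ℤ) :
    Submodule (MvPolynomial (Fin n) K) (FreeMod K n m) :=
  Submodule.span (MvPolynomial (Fin n) K) (gradedPiece d M a : Set (FreeMod K n m))

end Grading

section InitialModule

variable {K : Type*} [Field K] {n m : ℕ}

/-- The weight `ω · u + ε_j` of the monomial `X^u e_j`. -/
def monomialWeight (ω : Fin n → ℕ) (ε : Fin m → ℕ) (u : Fin n →₀ ℕ) (j : Fin m) : ℕ :=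
  (∑ k, ω k * u k) + ε j

/-- The largest weight of a monomial occurring in `f` (and `0` if `f = 0`). -/
noncomputable def maxWeight (ω : Fin n → ℕ) (ε : Fin m → ℕ) (f : FreeMod K n m) : ℕ :=
  Finset.univ.sup fun j => (f j).support.sup fun u => monomialWeight ω ε u j

/-- The initial part of `f`: the sum, with coefficients, of all monomials of `f` that have the
largest weight. -/
noncomputable def initialPart (ω : Fin n → ℕ) (ε : Fin m → ℕ) (f : FreeMod K n m) :
    FreeMod K n m :=
  fun j => ∑ u ∈ (f j).support with monomialWeight ω ε u j = maxWeight ω ε f,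
    monomial u (coeff u (f j))

/-- The initial module of `M`: the submodule of `F` generated by the initial parts of the elements
of `M`. -/
noncomputable def initialModule (ω : Fin n → ℕ) (ε : Fin m → ℕ)
    (M : Submodule (MvPolynomial (Fin n) K) (FreeMod K n m)) :
    Submodule (MvPolynomial (Fin n) K) (FreeMod K n m) :=
  Submodule.span (MvPolynomial (Fin n) K) (initialPart ω ε '' (M : Set (FreeMod K n m)))

end InitialModule

section Resolutions

/-- The homogeneous maximal ideal `(X_1, …, X_n)` of `K[X_1, …, X_n]`. -/
noncomputable def irrelevantIdeal (K : Type*) [Field K] (n : ℕ) : Ideal (MvPolynomial (Fin n) K) :=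
  Ideal.span (Set.range X)

variable {K : Type*} [Field K] {n m : ℕ}

/-- A minimal graded free resolution `⋯ → F_2 → F_1 → F_0 → M → 0` of a submodule `M` of the graded
free module `F = ⨁ A(-d_j)`. Here `F_i` has rank `rank i` and its `k`-th basis element has degree
`deg i k`, the maps are homogeneous of degree `0`, the sequence is exact, and the image of
`F_{i+1} → F_i` lies in `𝔪 F_i`. -/
structure MinimalResolution (d : Fin m → ℤ)
    (M : Submodule (MvPolynomial (Fin n) K) (FreeMod K n m)) where
  rank : ℕ → ℕ
  deg : ∀ i, Fin (rank i) → ℤ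
  aug : FreeMod K n (rank 0) →ₗ[MvPolynomial (Fin n) K] FreeMod K n m
  diff : ∀ i, FreeMod K n (rank (i + 1)) →ₗ[MvPolynomial (Fin n) K] FreeMod K n (rank i)
  aug_mem : ∀ k, aug (Pi.single k 1) ∈ degreePart d (deg 0 k)
  diff_mem : ∀ i k, diff i (Pi.single k 1) ∈ degreePart (deg i) (deg (i + 1) k)
  range_aug : LinearMap.range aug = M
  range_diff_zero : LinearMap.range (diff 0) = LinearMap.ker aug
  range_diff_succ : ∀ i, LinearMap.range (diff (i + 1)) = LinearMap.ker (diff i)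
  minimal : ∀ i, LinearMap.range (diff i) ≤
    irrelevantIdeal K n • (⊤ : Submodule (MvPolynomial (Fin n) K) (FreeMod K n (rank i)))

open Classical in
/-- The graded Betti number `β_{i,j}(M)`: the number of basis elements of degree `j` of the `i`-th
module in a minimal graded free resolution of `M`. (A graded submodule of `F` has such a
resolution, and it is unique up to isomorphism; the value `0` is used if `M` is not graded.) -/
noncomputable def gradedBetti (d : Fin m → ℤ)
    (M : Submodule (MvPolynomial (Fin n) K) (FreeMod K n m)) (i : ℕ) (j : ℤ) : ℕ :=
  if h : Nonempty (MinimalResolution d M) then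
    (Finset.univ.filter fun k => h.some.deg i k = j).card
  else 0

open Classical in
/-- The total Betti number `β_i(M)`: the rank of the `i`-th module in a minimal graded free
resolution of `M`, which is also `∑_j β_{i,j}(M)`. -/
noncomputable def betti (d : Fin m → ℤ)
    (M : Submodule (MvPolynomial (Fin n) K) (FreeMod K n m)) (i : ℕ) : ℕ :=
  if h : Nonempty (MinimalResolution d M) then h.some.rank i else 0

/-- The Castelnuovo-Mumford regularity `sup {j - i | β_{i,j}(M) ≠ 0}`; it is `-∞` for `M = 0`. -/
noncomputable def regularity (d : Fin m → ℤ)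
    (M : Submodule (MvPolynomial (Fin n) K) (FreeMod K n m)) : WithBot (WithTop ℤ) :=
  ⨆ (i : ℕ) (j : ℤ) (_ : gradedBetti d M i j ≠ 0), (((j - (i : ℤ) : ℤ) : WithTop ℤ) :
    WithBot (WithTop ℤ))

/-- `M` is `r`-componentwise regular: `reg M_⟨a⟩ ≤ a + r` for all `a`. -/
def IsComponentwiseRegular (d : Fin m → ℤ)
    (M : Submodule (MvPolynomial (Fin n) K) (FreeMod K n m)) (r : ℤ) : Prop :=
  ∀ a : ℤ, regularity d (generatedInDegree d M a) ≤ (((a + r : ℤ) : WithTop ℤ) :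
    WithBot (WithTop ℤ))

/-- `M` is componentwise linear: `reg M_⟨a⟩ ≤ a` for all `a`. As `M_⟨a⟩` is generated in degree `a`,
this says that each nonzero `M_⟨a⟩` has a linear resolution. -/
def IsComponentwiseLinear (d : Fin m → ℤ)
    (M : Submodule (MvPolynomial (Fin n) K) (FreeMod K n m)) : Prop :=
  IsComponentwiseRegular d M 0

end Resolutions

end GradedFree

/-! Fix `a`, write `in` for the initial module, and put N = in(M)_⟨a⟩. Always N ⊆ in(M_⟨a⟩); the
theorem follows once these are equal. Indeed, the minimal resolution of an initial module lifts to a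
graded, possibly nonminimal, resolution of the original module with the same ranks and degrees
(`exists_lifted_resolution`), so reg M_⟨a⟩ ≤ reg in(M_⟨a⟩) = reg N ≤ a.

Equality is a form of Buchberger's criterion (`initialModule_generatedInDegree_eq`). As reg N ≤ a,
the module N is generated in degree a and its syzygies in degrees at most a + 1. It is therefore
enough that the leading components of elements of M_⟨a⟩ of degree a + 1 lie in N.

This is where the Betti numbers enter. Lift the minimal resolution of in(M) to a resolution R of M.
Its rank in homological degree 1 is β_1(in(M)) = β_1(M), so comparison with a minimal resolution of
M shows that the map F_1 → F_0 of R has no constant entries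
(`GradedResolution.IsMinimal.constantCoeff_diff_eq_zero`). Hence the lifted generators f_k of M are
minimal. An element g of degree a + 1 in M_⟨a⟩ lies in 𝔪M, so a homogeneous standard representation
g = ∑ c_k f_k has no constant coefficients. Only generators of degree at most a occur in it, and the
leading component of g, computed from the c_k and the initial parts of these f_k, lies in N
(`proj_mem_generatedInDegree_initialModule`). -/

namespace GradedFree

open MvPolynomial

/-! ### Gradings by linear functions of exponents, leading components and division -/

section ExponentGrading

variable {K : Type*} [Field K] {n m r : ℕ}

/-- The elements of `F` all of whose monomials `X^u e_j` satisfy `P j u`. -/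
noncomputable def supportedOn (K : Type*) [Field K] {n m : ℕ}
    (P : Fin m → (Fin n →₀ ℕ) → Prop) : Submodule K (FreeMod K n m) where
  carrier := {f | ∀ j u, coeff u (f j) ≠ 0 → P j u}
  zero_mem' := fun j u h => absurd (by simp) h
  add_mem' := by
    intro f g hf hg j u h
    by_cases hfu : coeff u (f j) = 0
    · refine hg j u fun hgu => h ?_
      simp [hfu, hgu]
    · exact hf j u hfu
  smul_mem' := by
    intro c f hf j u h
    refine hf j u fun hfu => h ?_
    simp [hfu]

/-- The component of value `a` for the grading in which `X^u e_j` has value `l u + δ j`. -/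
noncomputable abbrev part (K : Type*) [Field K] {n m : ℕ} (l : (Fin n →₀ ℕ) →+ ℤ)
    (δ : Fin m → ℤ) (a : ℤ) : Submodule K (FreeMod K n m) :=
  supportedOn K fun j u => l u + δ j = a

/-- The elements all of whose monomials have value at most `a`. -/
noncomputable abbrev partLE (K : Type*) [Field K] {n m : ℕ} (l : (Fin n →₀ ℕ) →+ ℤ)
    (δ : Fin m → ℤ) (a : ℤ) : Submodule K (FreeMod K n m) :=
  supportedOn K fun j u => l u + δ j ≤ a

theorem supportedOn_mono {P Q : Fin m → (Fin n →₀ ℕ) → Prop} (h : ∀ j u, P j u → Q j u) :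
    supportedOn K P ≤ supportedOn K Q := fun _ hf j u hu => h j u (hf j u hu)

theorem freeMod_ext {f g : FreeMod K n m} (h : ∀ j u, coeff u (f j) = coeff u (g j)) : f = g :=
  funext fun j => MvPolynomial.ext _ _ (h j)

theorem coeff_sum_monomial_filter (p : MvPolynomial (Fin n) K) (P : (Fin n →₀ ℕ) → Prop)
    [DecidablePred P] (u : Fin n →₀ ℕ) :
    coeff u (∑ v ∈ p.support with P v, monomial v (coeff v p)) = if P u then coeff u p else 0 := by
  simp only [coeff_sum, coeff_monomial, Finset.sum_ite_eq', Finset.mem_filter, mem_support_iff]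
  by_cases h : P u <;> simp +contextual [h]

/-- The projection onto the component of value `a`. -/
noncomputable def proj (l : (Fin n →₀ ℕ) →+ ℤ) (δ : Fin m → ℤ) (a : ℤ) :
    FreeMod K n m →ₗ[K] FreeMod K n m where
  toFun f j := ∑ u ∈ (f j).support with l u + δ j = a, monomial u (coeff u (f j))
  map_add' f g := by
    refine freeMod_ext fun j u => ?_
    refine (coeff_sum_monomial_filter ((f + g) j) (fun u => l u + δ j = a) u).trans ?_
    simp only [Pi.add_apply, coeff_add, coeff_sum_monomial_filter]
    split_ifs <;> simp
  map_smul' c f := by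
    refine freeMod_ext fun j u => ?_
    refine (coeff_sum_monomial_filter ((c • f) j) (fun u => l u + δ j = a) u).trans ?_
    simp only [Pi.smul_apply, coeff_smul, RingHom.id_apply, coeff_sum_monomial_filter]
    split_ifs <;> simp

variable {l : (Fin n →₀ ℕ) →+ ℤ} {δ : Fin m → ℤ}

theorem coeff_proj (a : ℤ) (f : FreeMod K n m) (j : Fin m) (u : Fin n →₀ ℕ) :
    coeff u (proj l δ a f j) = if l u + δ j = a then coeff u (f j) else 0 :=
  coeff_sum_monomial_filter (f j) (fun u => l u + δ j = a) u

theorem proj_mem_part (a : ℤ) (f : FreeMod K n m) : proj l δ a f ∈ part K l δ a := by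
  intro j u h
  rw [coeff_proj] at h
  exact of_not_not fun h' => h (if_neg h')

theorem proj_mem_supportedOn {P : Fin m → (Fin n →₀ ℕ) → Prop} {a : ℤ} {f : FreeMod K n m}
    (hf : f ∈ supportedOn K P) : proj l δ a f ∈ supportedOn K P := by
  intro j u h
  rw [coeff_proj] at h
  exact hf j u fun h' => h (by simp [h'])

theorem proj_eq_self {a : ℤ} {f : FreeMod K n m} (hf : f ∈ part K l δ a) : proj l δ a f = f := by
  refine freeMod_ext fun j u => ?_
  rw [coeff_proj]
  split_ifs with h
  · rfl
  · exact of_not_not fun h' => h (hf j u fun h'' => h' h''.symm)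

theorem proj_eq_zero {a : ℤ} {f : FreeMod K n m}
    (hf : f ∈ supportedOn K fun j u => l u + δ j ≠ a) : proj l δ a f = 0 := by
  refine freeMod_ext fun j u => ?_
  rw [coeff_proj]
  split_ifs with h
  · exact of_not_not fun h' => hf j u h' h
  · simp

theorem proj_of_mem_part {a b : ℤ} {f : FreeMod K n m} (hf : f ∈ part K l δ b) :
    proj l δ a f = if a = b then f else 0 := by
  split_ifs with h
  · exact proj_eq_self (h ▸ hf)
  · exact proj_eq_zero (supportedOn_mono (fun j u (hu : _ = b) (hu' : _ = a) => h (hu'.symm.trans hu)) hf)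

theorem proj_proj (a : ℤ) (f : FreeMod K n m) : proj l δ a (proj l δ a f) = proj l δ a f :=
  proj_eq_self (proj_mem_part a f)

theorem proj_comm {l' : (Fin n →₀ ℕ) →+ ℤ} {δ' : Fin m → ℤ} (a b : ℤ) (f : FreeMod K n m) :
    proj l δ a (proj l' δ' b f) = proj l' δ' b (proj l δ a f) := by
  refine freeMod_ext fun j u => ?_
  simp only [coeff_proj]
  split_ifs <;> rfl

theorem part_le_partLE (a : ℤ) : part K l δ a ≤ partLE K l δ a :=
  supportedOn_mono fun _ _ h => h.le

theorem partLE_mono {a b : ℤ} (h : a ≤ b) : partLE K l δ a ≤ partLE K l δ b :=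
  supportedOn_mono fun _ _ h' => h'.trans h

/-- Values are integers, so losing the top component lowers the bound by a full unit. Every descent
on weights below uses this. -/
theorem mem_partLE_pred {a : ℤ} {f : FreeMod K n m} (hf : f ∈ partLE K l δ a)
    (h0 : proj l δ a f = 0) : f ∈ partLE K l δ (a - 1) := by
  intro j u hu
  refine Int.le_sub_one_of_lt (lt_of_le_of_ne (hf j u hu) fun h => hu ?_)
  rw [← if_pos h (t := coeff u (f j)) (e := 0), ← coeff_proj, h0]
  simp

theorem proj_eq_zero_of_lt {a b : ℤ} {f : FreeMod K n m} (hf : f ∈ partLE K l δ b) (h : b < a) :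
    proj l δ a f = 0 :=
  proj_eq_zero (supportedOn_mono (fun _ _ hu => (hu.trans_lt h).ne) hf)

theorem exists_sum_proj (l : (Fin n →₀ ℕ) →+ ℤ) (δ : Fin m → ℤ) (f : FreeMod K n m) :
    ∃ s : Finset ℤ, f = ∑ a ∈ s, proj l δ a f := by
  classical
  refine ⟨Finset.univ.biUnion fun j => (f j).support.image fun u => l u + δ j,
    freeMod_ext fun j u => ?_⟩
  rw [Finset.sum_apply, coeff_sum]
  simp only [coeff_proj, Finset.sum_ite_eq]
  split_ifs with h
  · rfl
  · by_contra hu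
    exact h (Finset.mem_biUnion.2 ⟨j, Finset.mem_univ _,
      Finset.mem_image.2 ⟨u, mem_support_iff.2 hu, rfl⟩⟩)

theorem mem_of_forall_proj_mem {U : Submodule K (FreeMod K n m)} {f : FreeMod K n m}
    (l : (Fin n →₀ ℕ) →+ ℤ) (δ : Fin m → ℤ) (h : ∀ a, proj l δ a f ∈ U) : f ∈ U := by
  obtain ⟨s, hs⟩ := exists_sum_proj l δ f
  rw [hs]
  exact U.sum_mem fun a _ => h a

theorem coeff_monomial_smul (u v : Fin n →₀ ℕ) (x : K) (f : FreeMod K n m) (j : Fin m)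
    (h : coeff v ((monomial u x • f) j) ≠ 0) : ∃ w, v = u + w ∧ coeff w (f j) ≠ 0 := by
  rw [Pi.smul_apply, smul_eq_mul, coeff_monomial_mul'] at h
  split_ifs at h with huv
  · exact ⟨v - u, (add_tsub_cancel_of_le huv).symm, right_ne_zero_of_mul h⟩
  · exact absurd rfl h

theorem monomial_smul_mem_part {a : ℤ} {f : FreeMod K n m} (hf : f ∈ part K l δ a)
    (u : Fin n →₀ ℕ) (x : K) : monomial u x • f ∈ part K l δ (l u + a) := by
  intro j v h
  obtain ⟨w, rfl, hw⟩ := coeff_monomial_smul _ _ _ _ _ h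
  rw [map_add, add_assoc, hf j w hw]

theorem monomial_smul_mem_partLE {a : ℤ} {f : FreeMod K n m} (hf : f ∈ partLE K l δ a)
    (u : Fin n →₀ ℕ) (x : K) : monomial u x • f ∈ partLE K l δ (l u + a) := by
  intro j v h
  obtain ⟨w, rfl, hw⟩ := coeff_monomial_smul _ _ _ _ _ h
  have := hf j w hw
  rw [map_add]
  omega

theorem proj_monomial_smul (a : ℤ) (f : FreeMod K n m) (u : Fin n →₀ ℕ) (x : K) :
    proj l δ a (monomial u x • f) = monomial u x • proj l δ (a - l u) f := by
  refine freeMod_ext fun j v => ?_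
  rw [coeff_proj, Pi.smul_apply, Pi.smul_apply, smul_eq_mul, smul_eq_mul, coeff_monomial_mul',
    coeff_monomial_mul', coeff_proj]
  by_cases huv : u ≤ v
  · obtain ⟨w, rfl⟩ := exists_add_of_le huv
    simp only [huv, if_true, add_tsub_cancel_left, map_add]
    split_ifs <;> first | rfl | (exfalso; omega) | simp
  · simp [huv]

/-- A `K`-subspace that is stable under multiplication by monomials is stable under
multiplication by polynomials. -/
theorem smul_mem_of_monomial_smul_mem (U : Submodule K (FreeMod K n m))
    (h : ∀ (u : Fin n →₀ ℕ) (x : K), ∀ f ∈ U, monomial u x • f ∈ U)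
    (q : MvPolynomial (Fin n) K) {f : FreeMod K n m} (hf : f ∈ U) : q • f ∈ U := by
  induction q using MvPolynomial.induction_on' with
  | monomial u x => exact h u x f hf
  | add p q hp hq => rw [add_smul]; exact U.add_mem hp hq

theorem linearMap_eq_sum (φ : FreeMod K n r →ₗ[MvPolynomial (Fin n) K] FreeMod K n m)
    (c : FreeMod K n r) : φ c = ∑ k, c k • φ (Pi.single k 1) := by
  conv_lhs => rw [pi_eq_sum_univ' c, map_sum]
  exact Finset.sum_congr rfl fun k _ => map_smul φ _ _

theorem linearMap_mem_of_monomial (φ : FreeMod K n r →ₗ[MvPolynomial (Fin n) K] FreeMod K n m)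
    (U : Submodule K (FreeMod K n m)) {c : FreeMod K n r}
    (h : ∀ k u, coeff u (c k) ≠ 0 → monomial u (coeff u (c k)) • φ (Pi.single k 1) ∈ U) :
    φ c ∈ U := by
  rw [linearMap_eq_sum]
  refine U.sum_mem fun k _ => ?_
  rw [(c k).as_sum, Finset.sum_smul]
  exact U.sum_mem fun u hu => h k u (mem_support_iff.1 hu)

/-- A map that raises the values of the basis elements by at most `s` does so everywhere. -/
theorem map_mem_partLE {δ' : Fin r → ℤ} {s : ℤ}
    {φ : FreeMod K n r →ₗ[MvPolynomial (Fin n) K] FreeMod K n m}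
    (hφ : ∀ k, φ (Pi.single k 1) ∈ partLE K l δ (δ' k + s)) {W : ℤ} {c : FreeMod K n r}
    (hc : c ∈ partLE K l δ' W) : φ c ∈ partLE K l δ (W + s) := by
  refine linearMap_mem_of_monomial φ _ fun k u hu => ?_
  refine partLE_mono ?_ (monomial_smul_mem_partLE (hφ k) u _)
  have := hc k u hu
  omega

theorem map_mem_part {δ' : Fin r → ℤ}
    {φ : FreeMod K n r →ₗ[MvPolynomial (Fin n) K] FreeMod K n m}
    (hφ : ∀ k, φ (Pi.single k 1) ∈ part K l δ (δ' k)) {W : ℤ} {c : FreeMod K n r}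
    (hc : c ∈ part K l δ' W) : φ c ∈ part K l δ W := by
  refine linearMap_mem_of_monomial φ _ fun k u hu => ?_
  have := monomial_smul_mem_part (hφ k) u (coeff u (c k))
  rwa [hc k u hu] at this

theorem map_proj {δ' : Fin r → ℤ}
    {φ : FreeMod K n r →ₗ[MvPolynomial (Fin n) K] FreeMod K n m}
    (hφ : ∀ k, φ (Pi.single k 1) ∈ part K l δ (δ' k)) (a : ℤ) (c : FreeMod K n r) :
    φ (proj l δ' a c) = proj l δ a (φ c) := by
  obtain ⟨s, hs⟩ := exists_sum_proj l δ' c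
  have key : ∀ b, φ (proj l δ' a (proj l δ' b c)) = proj l δ a (φ (proj l δ' b c)) := by
    intro b
    rw [proj_of_mem_part (proj_mem_part b c),
      proj_of_mem_part (map_mem_part hφ (proj_mem_part b c))]
    split_ifs <;> simp
  rw [hs]
  simp only [map_sum, key]

/-- If `φ₀` is the leading part of `φ`, then the leading part of `φ c` is computed by `φ₀`. -/
theorem proj_map_of_partLE {δ' : Fin r → ℤ}
    {φ φ₀ : FreeMod K n r →ₗ[MvPolynomial (Fin n) K] FreeMod K n m}
    (hφ : ∀ k, φ (Pi.single k 1) ∈ partLE K l δ (δ' k))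
    (hφ₀ : ∀ k, φ₀ (Pi.single k 1) = proj l δ (δ' k) (φ (Pi.single k 1)))
    {W : ℤ} {c : FreeMod K n r} (hc : c ∈ partLE K l δ' W) :
    proj l δ W (φ c) = φ₀ (proj l δ' W c) := by
  have h₀ : ∀ k, φ₀ (Pi.single k 1) ∈ part K l δ (δ' k) := fun k => by
    rw [hφ₀]; exact proj_mem_part _ _
  rw [map_proj h₀, ← sub_eq_zero, ← map_sub, ← LinearMap.sub_apply]
  -- The shift is `-1` because `φ - φ₀` has lost the top component on each basis element, so it
  -- strictly lowers the bound.
  refine proj_eq_zero_of_lt (map_mem_partLE (δ' := δ') (s := -1) (fun k => ?_) hc) (by omega)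
  rw [LinearMap.sub_apply, ← sub_eq_add_neg]
  refine mem_partLE_pred (Submodule.sub_mem _ (hφ k) (part_le_partLE _ (h₀ k))) ?_
  rw [map_sub, proj_eq_self (h₀ k), hφ₀, sub_self]

theorem eq_zero_of_mem_partLE_of_neg {a : ℤ} (hl : ∀ u, 0 ≤ l u) (hδ : ∀ j, 0 ≤ δ j) (ha : a < 0)
    {f : FreeMod K n m} (hf : f ∈ partLE K l δ a) : f = 0 := by
  refine freeMod_ext fun j u => of_not_not fun h => ?_
  have := hf j u (by simpa using h)
  have := hl u
  have := hδ j
  omega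

/-- Division: if the leading part of each element of `U` is of the form `φ₀ v` with `v ∈ V`, then
each element of `U` is of the form `φ v` with `v ∈ V`, without cancellation of leading parts. -/
theorem exists_standard_representation (hl : ∀ u, 0 ≤ l u) (hδ : ∀ j, 0 ≤ δ j)
    {δ' : Fin r → ℤ}
    {φ φ₀ : FreeMod K n r →ₗ[MvPolynomial (Fin n) K] FreeMod K n m}
    (hφ : ∀ k, φ (Pi.single k 1) ∈ partLE K l δ (δ' k))
    (hφ₀ : ∀ k, φ₀ (Pi.single k 1) = proj l δ (δ' k) (φ (Pi.single k 1)))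
    {U : Submodule K (FreeMod K n m)} {V : Submodule K (FreeMod K n r)}
    (hVproj : ∀ v ∈ V, ∀ W, proj l δ' W v ∈ V) (hVU : ∀ v ∈ V, φ v ∈ U)
    (hlead : ∀ g ∈ U, ∀ W, g ∈ partLE K l δ W → ∃ v ∈ V, φ₀ v = proj l δ W g)
    {W : ℤ} {g : FreeMod K n m} (hg : g ∈ U) (hgW : g ∈ partLE K l δ W) :
    ∃ v ∈ V, v ∈ partLE K l δ' W ∧ φ v = g := by
  have h₀ : ∀ k, φ₀ (Pi.single k 1) ∈ part K l δ (δ' k) := fun k => by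
    rw [hφ₀]; exact proj_mem_part _ _
  -- Each division step lowers `W` by one and elements of negative value vanish, so `N` bounds the
  -- number of steps.
  obtain ⟨N, hN⟩ : ∃ N : ℕ, W < N := ⟨(W + 1).toNat, by omega⟩
  induction N generalizing W g with
  | zero =>
    refine ⟨0, V.zero_mem, Submodule.zero_mem _, ?_⟩
    rw [eq_zero_of_mem_partLE_of_neg hl hδ (by simpa using hN) hgW, map_zero]
  | succ N ih =>
    obtain ⟨v, hv, hvg⟩ := hlead g hg W hgW
    have hv' := hVproj v hv W
    have hvW : proj l δ' W v ∈ partLE K l δ' W := part_le_partLE _ (proj_mem_part _ _)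
    have hφv := map_mem_partLE (s := 0) (by simpa using hφ) hvW
    rw [add_zero] at hφv
    have hlow : g - φ (proj l δ' W v) ∈ partLE K l δ (W - 1) := by
      refine mem_partLE_pred (Submodule.sub_mem _ hgW hφv) ?_
      rw [map_sub, proj_map_of_partLE hφ hφ₀ hvW, proj_proj, map_proj h₀, hvg, proj_proj, sub_self]
    obtain ⟨v₂, hv₂, hv₂W, hv₂g⟩ := ih (U.sub_mem hg (hVU _ hv')) hlow (by push_cast at hN; omega)
    refine ⟨_, V.add_mem hv' hv₂, Submodule.add_mem _ hvW (partLE_mono (by omega) hv₂W), ?_⟩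
    rw [map_add, hv₂g, add_sub_cancel]

end ExponentGrading

/-! ### Initial modules described by weight components -/

section InitialModuleLemmas

variable {K : Type*} [Field K] {n m r : ℕ}

/-- The total degree of an exponent vector, as an integer. -/
noncomputable def degHom (n : ℕ) : (Fin n →₀ ℕ) →+ ℤ :=
  (Nat.castAddMonoidHom ℤ).comp Finsupp.degree

/-- The weight `ω · u` of an exponent vector, as an integer. -/
noncomputable def weightHom {n : ℕ} (ω : Fin n → ℕ) : (Fin n →₀ ℕ) →+ ℤ where
  toFun u := ∑ k, (ω k : ℤ) * u k
  map_zero' := by simp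
  map_add' u v := by simp [mul_add, Finset.sum_add_distrib]

/-- Natural number weights, regarded as integers. -/
def intWeight {m : ℕ} (ε : Fin m → ℕ) : Fin m → ℤ := fun j => ε j

variable {ω : Fin n → ℕ} {ε : Fin m → ℕ} {d : Fin m → ℤ}
  {M : Submodule (MvPolynomial (Fin n) K) (FreeMod K n m)}

theorem weightHom_nonneg (u : Fin n →₀ ℕ) : 0 ≤ weightHom ω u := by
  change 0 ≤ ∑ k, (ω k : ℤ) * u k
  positivity

theorem intWeight_nonneg (j : Fin m) : 0 ≤ intWeight ε j := Int.natCast_nonneg _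

theorem mem_gradedPiece {a : ℤ} {f : FreeMod K n m} :
    f ∈ gradedPiece d M a ↔ f ∈ M ∧ f ∈ part K (degHom n) d a := Iff.rfl

theorem monomialWeight_cast (u : Fin n →₀ ℕ) (j : Fin m) :
    (monomialWeight ω ε u j : ℤ) = weightHom ω u + intWeight ε j := by
  simp [monomialWeight, weightHom, intWeight]

theorem mem_partLE_maxWeight (f : FreeMod K n m) :
    f ∈ partLE K (weightHom ω) (intWeight ε) (maxWeight ω ε f) := by
  intro j u hu
  rw [← monomialWeight_cast, Nat.cast_le]
  refine le_trans ?_ (Finset.le_sup (f := fun j => (f j).support.sup fun u =>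
    monomialWeight ω ε u j) (Finset.mem_univ j))
  exact Finset.le_sup (f := fun u => monomialWeight ω ε u j) (mem_support_iff.2 hu)

theorem initialPart_eq_proj (f : FreeMod K n m) :
    initialPart ω ε f = proj (weightHom ω) (intWeight ε) (maxWeight ω ε f) f := by
  refine freeMod_ext fun j u => ?_
  rw [coeff_proj]
  refine (coeff_sum_monomial_filter (f j)
    (fun u => monomialWeight ω ε u j = maxWeight ω ε f) u).trans ?_
  simp only [← monomialWeight_cast, Nat.cast_inj]

/-- This allows any upper bound `W` to replace `maxWeight`: the component at `W` is either zero or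
the initial part. -/
theorem maxWeight_eq_of_proj_ne_zero {W : ℤ} {f : FreeMod K n m}
    (hf : f ∈ partLE K (weightHom ω) (intWeight ε) W)
    (h0 : proj (weightHom ω) (intWeight ε) W f ≠ 0) : (maxWeight ω ε f : ℤ) = W := by
  refine le_antisymm ?_ (not_lt.1 fun h => h0 (proj_eq_zero_of_lt (mem_partLE_maxWeight f) h))
  have hW : 0 ≤ W := not_lt.1 fun h => h0 (by
    rw [eq_zero_of_mem_partLE_of_neg weightHom_nonneg intWeight_nonneg h hf, map_zero])
  lift W to ℕ using hW
  rw [Nat.cast_le]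
  refine Finset.sup_le fun j _ => Finset.sup_le fun u hu => ?_
  have : weightHom ω u + intWeight ε j ≤ W := hf j u (mem_support_iff.1 hu)
  rwa [← monomialWeight_cast, Nat.cast_le] at this

theorem proj_mem_initialModule {W : ℤ} {f : FreeMod K n m} (hfM : f ∈ M)
    (hf : f ∈ partLE K (weightHom ω) (intWeight ε) W) :
    proj (weightHom ω) (intWeight ε) W f ∈ initialModule ω ε M := by
  by_cases h0 : proj (weightHom ω) (intWeight ε) W f = 0
  · rw [h0]
    exact Submodule.zero_mem _
  · rw [← maxWeight_eq_of_proj_ne_zero hf h0, ← initialPart_eq_proj]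
    exact Submodule.subset_span ⟨f, hfM, rfl⟩

/-- The initial module consists of the elements all of whose weight components are leading
components of elements of `M`. -/
theorem mem_initialModule {x : FreeMod K n m} :
    x ∈ initialModule ω ε M ↔ ∀ W, ∃ p ∈ M, p ∈ partLE K (weightHom ω) (intWeight ε) W ∧
      proj (weightHom ω) (intWeight ε) W p = proj (weightHom ω) (intWeight ε) W x := by
  constructor
  · let U : Submodule K (FreeMod K n m) :=
      { carrier := {x | ∀ W, ∃ p ∈ M, p ∈ partLE K (weightHom ω) (intWeight ε) W ∧
          proj (weightHom ω) (intWeight ε) W p = proj (weightHom ω) (intWeight ε) W x}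
        zero_mem' := fun W => ⟨0, M.zero_mem, Submodule.zero_mem _, rfl⟩
        add_mem' := by
          intro x y hx hy W
          obtain ⟨p, hp, hpW, hpx⟩ := hx W
          obtain ⟨q, hq, hqW, hqy⟩ := hy W
          exact ⟨p + q, M.add_mem hp hq, Submodule.add_mem _ hpW hqW, by
            rw [map_add, map_add, hpx, hqy]⟩
        smul_mem' := by
          intro c x hx W
          obtain ⟨p, hp, hpW, hpx⟩ := hx W
          exact ⟨c • p, M.smul_of_tower_mem c hp, Submodule.smul_mem _ c hpW, by
            rw [map_smul, map_smul, hpx]⟩ }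
    intro hx
    change x ∈ U
    refine Submodule.span_induction (p := fun x _ => x ∈ U) ?_ U.zero_mem
      (fun x y _ _ hx hy => U.add_mem hx hy)
      (fun q x _ hx => smul_mem_of_monomial_smul_mem U ?_ q hx) hx
    · rintro _ ⟨f, hf, rfl⟩ W
      rw [initialPart_eq_proj, proj_of_mem_part (proj_mem_part _ _)]
      split_ifs with h
      · subst h
        exact ⟨f, hf, mem_partLE_maxWeight f, rfl⟩
      · exact ⟨0, M.zero_mem, Submodule.zero_mem _, map_zero _⟩
    · intro u c x hx W
      obtain ⟨p, hp, hpW, hpx⟩ := hx (W - weightHom ω u)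
      refine ⟨monomial u c • p, M.smul_mem _ hp, ?_, ?_⟩
      · have := monomial_smul_mem_partLE hpW u c
        rwa [add_sub_cancel] at this
      · rw [proj_monomial_smul, proj_monomial_smul, hpx]
  · intro h
    refine mem_of_forall_proj_mem (U := (initialModule ω ε M).restrictScalars K)
      (weightHom ω) (intWeight ε) fun W => ?_
    obtain ⟨p, hp, hpW, hpx⟩ := h W
    rw [← hpx]
    exact proj_mem_initialModule hp hpW

theorem proj_mem_of_mem_initialModule {x : FreeMod K n m} (hx : x ∈ initialModule ω ε M) (W : ℤ) :
    proj (weightHom ω) (intWeight ε) W x ∈ initialModule ω ε M := by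
  obtain ⟨p, hp, hpW, hpx⟩ := mem_initialModule.1 hx W
  rw [← hpx]
  exact proj_mem_initialModule hp hpW

/-- A submodule that is stable under taking weight components is its own initial module. -/
theorem initialModule_eq_self
    (h : ∀ x ∈ M, ∀ W, proj (weightHom ω) (intWeight ε) W x ∈ M) :
    initialModule ω ε M = M := by
  refine le_antisymm (Submodule.span_le.2 ?_) fun x hx => mem_initialModule.2 fun W =>
    ⟨_, h x hx W, part_le_partLE _ (proj_mem_part _ _), proj_proj _ _⟩
  rintro _ ⟨f, hf, rfl⟩
  rw [initialPart_eq_proj]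
  exact h f hf _

theorem isGraded_iff : IsGraded d M ↔ ∀ f ∈ M, ∀ a, proj (degHom n) d a f ∈ M := by
  constructor
  · intro h f hf a
    have hf' : f ∈ ⨆ a, gradedPiece d M a := by rw [h]; exact hf
    refine Submodule.iSup_induction (motive := fun f => proj (degHom n) d a f ∈ M) _ hf' ?_ ?_ ?_
    · intro b x hx
      rw [proj_of_mem_part (mem_gradedPiece.1 hx).2]
      split_ifs
      · exact hx.1
      · exact M.zero_mem
    · rw [map_zero]; exact M.zero_mem
    · intro x y hx hy
      rw [map_add]; exact M.add_mem hx hy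
  · intro h
    refine le_antisymm (iSup_le fun a => inf_le_left) fun f hf => ?_
    exact mem_of_forall_proj_mem (degHom n) d fun a =>
      Submodule.mem_iSup_of_mem a (mem_gradedPiece.2 ⟨h f hf a, proj_mem_part _ _⟩)

/-- A homogeneous version of `mem_initialModule`. -/
theorem exists_gradedPiece_proj_eq (hM : IsGraded d M) {x : FreeMod K n m}
    (hx : x ∈ initialModule ω ε M) {a : ℤ} (hxa : x ∈ part K (degHom n) d a) (W : ℤ) :
    ∃ p ∈ gradedPiece d M a, p ∈ partLE K (weightHom ω) (intWeight ε) W ∧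
      proj (weightHom ω) (intWeight ε) W p = proj (weightHom ω) (intWeight ε) W x := by
  obtain ⟨p, hp, hpW, hpx⟩ := mem_initialModule.1 hx W
  refine ⟨proj (degHom n) d a p, mem_gradedPiece.2 ⟨isGraded_iff.1 hM p hp a, proj_mem_part _ _⟩,
    proj_mem_supportedOn hpW, ?_⟩
  rw [proj_comm, hpx, proj_comm, proj_eq_self hxa]

theorem isGraded_initialModule (hM : IsGraded d M) : IsGraded d (initialModule ω ε M) := by
  refine isGraded_iff.2 fun x hx a => mem_initialModule.2 fun W => ?_
  obtain ⟨p, hp, hpW, hpx⟩ := mem_initialModule.1 hx W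
  exact ⟨proj (degHom n) d a p, isGraded_iff.1 hM p hp a, proj_mem_supportedOn hpW, by
    rw [proj_comm, hpx, proj_comm]⟩

/-- The initial module is generated by the initial parts of the homogeneous elements of `M`. -/
theorem initialModule_eq_span_homogeneous (hM : IsGraded d M) :
    initialModule ω ε M = Submodule.span (MvPolynomial (Fin n) K)
      (initialPart ω ε '' {f | ∃ a, f ∈ gradedPiece d M a}) := by
  refine le_antisymm (fun x hx => ?_) (Submodule.span_mono (Set.image_mono ?_))
  · refine mem_of_forall_proj_mem (U := (Submodule.span (MvPolynomial (Fin n) K)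
      (initialPart ω ε '' {f | ∃ a, f ∈ gradedPiece d M a})).restrictScalars K)
      (degHom n) d fun a => mem_of_forall_proj_mem (weightHom ω) (intWeight ε) fun W => ?_
    obtain ⟨p, hp, hpW, hpx⟩ := exists_gradedPiece_proj_eq hM
      (isGraded_iff.1 (isGraded_initialModule hM) x hx a) (proj_mem_part a x) W
    rw [← hpx]
    by_cases h0 : proj (weightHom ω) (intWeight ε) W p = 0
    · rw [h0]; exact Submodule.zero_mem _
    · rw [← maxWeight_eq_of_proj_ne_zero hpW h0, ← initialPart_eq_proj]
      exact Submodule.subset_span ⟨p, ⟨a, hp⟩, rfl⟩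
  · rintro f ⟨a, hf⟩
    exact hf.1

theorem isGraded_generatedInDegree (a : ℤ) : IsGraded d (generatedInDegree d M a) := by
  refine isGraded_iff.2 fun f hf b => ?_
  let U : Submodule K (FreeMod K n m) :=
    ⨅ b, ((generatedInDegree d M a).restrictScalars K).comap (proj (degHom n) d b)
  have hU : ∀ {x}, x ∈ U ↔ ∀ b, proj (degHom n) d b x ∈ generatedInDegree d M a := by
    intro x
    simp [U, Submodule.mem_iInf]
  refine hU.1 (Submodule.span_induction (p := fun x _ => x ∈ U) ?_ U.zero_mem
      (fun x y _ _ hx hy => U.add_mem hx hy)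
      (fun q x _ hx => smul_mem_of_monomial_smul_mem U ?_ q hx) hf) b
  · intro x hx
    refine hU.2 fun b => ?_
    rw [proj_of_mem_part (mem_gradedPiece.1 hx).2]
    split_ifs
    · exact Submodule.subset_span hx
    · exact Submodule.zero_mem _
  · intro u c x hx
    refine hU.2 fun b => ?_
    rw [proj_monomial_smul]
    exact Submodule.smul_mem _ _ (hU.1 hx _)

/-- The kernel of a homogeneous map is graded. -/
theorem isGraded_ker {d' : Fin r → ℤ}
    {φ : FreeMod K n r →ₗ[MvPolynomial (Fin n) K] FreeMod K n m}
    (hφ : ∀ k, φ (Pi.single k 1) ∈ part K (degHom n) d (d' k)) : IsGraded d' (LinearMap.ker φ) := by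
  refine isGraded_iff.2 fun f hf a => ?_
  rw [LinearMap.mem_ker] at hf ⊢
  rw [map_proj hφ, hf, map_zero]

end InitialModuleLemmas

/-! ### Generators with minimal leading parts, standard representations and syzygies -/

section LeadingGenerators

variable {K : Type*} [Field K] {n m r : ℕ}

theorem mem_irrelevantIdeal_iff {p : MvPolynomial (Fin n) K} :
    p ∈ irrelevantIdeal K n ↔ constantCoeff p = 0 := by
  have := mem_pow_idealOfVars_iff' (σ := Fin n) 1 p
  rw [pow_one] at this
  refine this.trans ⟨fun h => h 0 (by simp), fun h u hu => ?_⟩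
  rw [Nat.lt_one_iff, Finsupp.degree_eq_zero_iff] at hu
  rw [hu]
  exact h

theorem mem_irrelevantIdeal_smul_top {x : FreeMod K n m} :
    x ∈ irrelevantIdeal K n • (⊤ : Submodule (MvPolynomial (Fin n) K) (FreeMod K n m)) ↔
      ∀ k, constantCoeff (x k) = 0 := by
  constructor
  · intro hx k
    refine Submodule.smul_induction_on (p := fun x => constantCoeff (x k) = 0) hx ?_ ?_
    · intro p hp y _
      rw [Pi.smul_apply, smul_eq_mul, map_mul, mem_irrelevantIdeal_iff.1 hp, zero_mul]
    · intro x y hx hy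
      rw [Pi.add_apply, map_add, hx, hy, add_zero]
  · intro h
    rw [pi_eq_sum_univ' x]
    exact Submodule.sum_mem _ fun k _ =>
      Submodule.smul_mem_smul (mem_irrelevantIdeal_iff.2 (h k)) trivial

theorem degHom_eq_zero_iff {u : Fin n →₀ ℕ} : degHom n u = 0 ↔ u = 0 := by
  rw [← Finsupp.degree_eq_zero_iff u]
  exact Int.natCast_eq_zero

theorem degHom_nonneg (u : Fin n →₀ ℕ) : 0 ≤ degHom n u := Int.natCast_nonneg _

/-- A homogeneous relation of the degree of a basis element has a constant coefficient there. -/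
theorem proj_apply_self_eq_C (d : Fin m → ℤ) (c : FreeMod K n m) (k : Fin m) :
    proj (degHom n) d (d k) c k = C (constantCoeff (c k)) := by
  refine MvPolynomial.ext _ _ fun u => ?_
  rw [coeff_proj, coeff_C]
  by_cases hu : u = 0
  · subst hu
    simp [constantCoeff_eq]
  · have : degHom n u ≠ 0 := fun h => hu (degHom_eq_zero_iff.1 h)
    rw [if_neg (by simpa using this), if_neg (Ne.symm hu)]

variable {ω : Fin n → ℕ} {ε : Fin m → ℕ} {d : Fin m → ℤ}
  {M : Submodule (MvPolynomial (Fin n) K) (FreeMod K n m)}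

theorem initialPart_mem_part {a : ℤ} {f : FreeMod K n m} (hf : f ∈ part K (degHom n) d a) :
    initialPart ω ε f ∈ part K (degHom n) d a := by
  rw [initialPart_eq_proj]
  exact proj_mem_supportedOn hf

/-- Homogeneous elements of `M` whose initial parts minimally generate the initial module. -/
theorem exists_leading_generators (ω : Fin n → ℕ) (ε : Fin m → ℕ) (hM : IsGraded d M) :
    ∃ (r : ℕ) (f : Fin r → FreeMod K n m) (d' : Fin r → ℤ),
      (∀ k, f k ∈ gradedPiece d M (d' k)) ∧
      LinearMap.range (Fintype.linearCombination (MvPolynomial (Fin n) K)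
        fun k => initialPart ω ε (f k)) = initialModule ω ε M ∧
      ∀ c ∈ LinearMap.ker (Fintype.linearCombination (MvPolynomial (Fin n) K)
        fun k => initialPart ω ε (f k)), ∀ k, constantCoeff (c k) = 0 := by
  classical
  let P : ℕ → Prop := fun r => ∃ (f : Fin r → FreeMod K n m) (d' : Fin r → ℤ),
      (∀ k, f k ∈ gradedPiece d M (d' k)) ∧
      Submodule.span (MvPolynomial (Fin n) K) (Set.range fun k => initialPart ω ε (f k)) =
        initialModule ω ε M
  have hP : ∃ r, P r := by
    obtain ⟨s, hs, hspan⟩ := Submodule.fg_span_iff_fg_span_finset_subset _ |>.1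
      (IsNoetherian.noetherian (Submodule.span (MvPolynomial (Fin n) K)
        (initialPart ω ε '' {f | ∃ a, f ∈ gradedPiece d M a})))
    have hs' : ∀ x : s, ∃ f, ∃ a, f ∈ gradedPiece d M a ∧ initialPart ω ε f = x := by
      intro x
      obtain ⟨f, ⟨a, hfa⟩, hfx⟩ := hs x.2
      exact ⟨f, a, hfa, hfx⟩
    choose f a hfa hfx using hs'
    refine ⟨s.card, f ∘ s.equivFin.symm, a ∘ s.equivFin.symm, fun k => hfa _, ?_⟩
    rw [initialModule_eq_span_homogeneous hM, hspan]
    congr 1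
    ext x
    simp only [Set.mem_range, Function.comp_apply, hfx]
    constructor
    · rintro ⟨k, rfl⟩
      exact (s.equivFin.symm k).2
    · intro hx
      exact ⟨s.equivFin ⟨x, hx⟩, by simp⟩
  obtain ⟨f, d', hf, hspan⟩ := Nat.find_spec hP
  refine ⟨Nat.find hP, f, d', hf, by rw [Fintype.range_linearCombination, hspan],
    fun c hc k₀ => of_not_not fun hck₀ => ?_⟩
  -- The minimal number of generators is generalized to a variable, so that it can be written as a
  -- successor and one generator dropped.
  have hmin : ∀ r < Nat.find hP, ¬ P r := fun r hr => Nat.find_min hP hr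
  revert f d' c k₀ hmin
  generalize Nat.find hP = r
  intro f d' hf hspan c hc k₀ hck₀ hmin
  obtain ⟨r, rfl⟩ : ∃ r', r = r' + 1 := ⟨r - 1, by have := k₀.2; omega⟩
  refine hmin r (Nat.lt_succ_self r) ⟨f ∘ k₀.succAbove, d' ∘ k₀.succAbove, fun k => hf _, ?_⟩
  rw [← hspan]
  refine le_antisymm (Submodule.span_mono ?_) (Submodule.span_le.2 ?_)
  · rintro _ ⟨k, rfl⟩
    exact ⟨_, rfl⟩
  set N := Submodule.span (MvPolynomial (Fin n) K)
    (Set.range fun k => initialPart ω ε ((f ∘ k₀.succAbove) k)) with hN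
  have hothers : ∀ k, initialPart ω ε (f (k₀.succAbove k)) ∈ N := fun k =>
    Submodule.subset_span ⟨k, rfl⟩
  rintro _ ⟨k, rfl⟩
  rcases Fin.eq_self_or_eq_succAbove k₀ k with rfl | ⟨k, rfl⟩
  swap
  · exact hothers k
  -- In degree `d' k` the relation has the nonzero constant of `c k` as its `k`-th coefficient, so
  -- it expresses the `k`-th initial part through the others.
  have hc' := map_proj (l := degHom n) (δ := d) (δ' := d') (φ := Fintype.linearCombination
    (MvPolynomial (Fin n) K) fun k => initialPart ω ε (f k)) (fun k => by
      rw [Fintype.linearCombination_apply_single, one_smul]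
      exact initialPart_mem_part (mem_gradedPiece.1 (hf k)).2) (d' k) c
  rw [LinearMap.mem_ker.1 hc, map_zero, Fintype.linearCombination_apply,
    Fin.sum_univ_succAbove _ k, proj_apply_self_eq_C, add_eq_zero_iff_eq_neg] at hc'
  have hmem : (C (constantCoeff (c k)) : MvPolynomial (Fin n) K) • initialPart ω ε (f k) ∈ N := by
    rw [hc']
    exact N.neg_mem (N.sum_mem fun i _ => N.smul_mem _ (hothers i))
  have := N.smul_mem (C (constantCoeff (c k))⁻¹) hmem
  rwa [smul_smul, ← C_mul, inv_mul_cancel₀ hck₀, C_1, one_smul] at this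

variable {ε' : Fin r → ℕ} {d' : Fin r → ℤ}
  {φ φ₀ : FreeMod K n r →ₗ[MvPolynomial (Fin n) K] FreeMod K n m}

/-- Homogeneous standard representations. -/
theorem exists_homogeneous_standard_representation
    (hφ : ∀ k, φ (Pi.single k 1) ∈ partLE K (weightHom ω) (intWeight ε) (intWeight ε' k))
    (hφ₀ : ∀ k, φ₀ (Pi.single k 1) =
      proj (weightHom ω) (intWeight ε) (intWeight ε' k) (φ (Pi.single k 1)))
    (hφd : ∀ k, φ (Pi.single k 1) ∈ part K (degHom n) d (d' k))
    (hrange : LinearMap.range φ ≤ M) {b : ℤ}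
    (hlead : ∀ g ∈ gradedPiece d M b, ∀ W, g ∈ partLE K (weightHom ω) (intWeight ε) W →
      proj (weightHom ω) (intWeight ε) W g ∈ LinearMap.range φ₀)
    {W : ℤ} {g : FreeMod K n m} (hg : g ∈ gradedPiece d M b)
    (hgW : g ∈ partLE K (weightHom ω) (intWeight ε) W) :
    ∃ v ∈ part K (degHom n) d' b, v ∈ partLE K (weightHom ω) (intWeight ε') W ∧ φ v = g := by
  have hφ₀d : ∀ k, φ₀ (Pi.single k 1) ∈ part K (degHom n) d (d' k) := fun k => by
    rw [hφ₀]
    exact proj_mem_supportedOn (hφd k)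
  refine exists_standard_representation weightHom_nonneg intWeight_nonneg hφ hφ₀
    (U := gradedPiece d M b) (fun v hv W => proj_mem_supportedOn hv)
    (fun v hv => mem_gradedPiece.2 ⟨hrange ⟨v, rfl⟩, map_mem_part hφd hv⟩)
    (fun g hg W hgW => ?_) hg hgW
  obtain ⟨v, hv⟩ := hlead g hg W hgW
  refine ⟨proj (degHom n) d' b v, proj_mem_part _ _, ?_⟩
  rw [map_proj hφ₀d, hv, proj_comm, proj_eq_self (mem_gradedPiece.1 hg).2]

theorem exists_standard_representation_of_range_eq
    (hφ : ∀ k, φ (Pi.single k 1) ∈ partLE K (weightHom ω) (intWeight ε) (intWeight ε' k))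
    (hφ₀ : ∀ k, φ₀ (Pi.single k 1) =
      proj (weightHom ω) (intWeight ε) (intWeight ε' k) (φ (Pi.single k 1)))
    (hrange : LinearMap.range φ ≤ M) (hrange₀ : LinearMap.range φ₀ = initialModule ω ε M)
    {W : ℤ} {g : FreeMod K n m} (hg : g ∈ M)
    (hgW : g ∈ partLE K (weightHom ω) (intWeight ε) W) :
    ∃ v ∈ partLE K (weightHom ω) (intWeight ε') W, φ v = g := by
  obtain ⟨v, -, hv⟩ := exists_standard_representation weightHom_nonneg intWeight_nonneg hφ hφ₀
    (U := M.restrictScalars K) (V := ⊤) (fun v _ W => trivial) (fun v _ => hrange ⟨v, rfl⟩)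
    (fun g hg W hgW => by
      have := proj_mem_initialModule hg hgW
      rw [← hrange₀] at this
      obtain ⟨v, hv⟩ := this
      exact ⟨v, trivial, hv⟩) hg hgW
  exact ⟨v, hv⟩

/-- If the leading parts of generators of `M` generate the initial module of `M`, then the initial
module of the syzygies is the module of syzygies of the leading parts. -/
theorem initialModule_ker
    (hφ : ∀ k, φ (Pi.single k 1) ∈ partLE K (weightHom ω) (intWeight ε) (intWeight ε' k))
    (hφ₀ : ∀ k, φ₀ (Pi.single k 1) =
      proj (weightHom ω) (intWeight ε) (intWeight ε' k) (φ (Pi.single k 1)))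
    (hrange : LinearMap.range φ ≤ M) (hrange₀ : LinearMap.range φ₀ = initialModule ω ε M) :
    initialModule ω ε' (LinearMap.ker φ) = LinearMap.ker φ₀ := by
  have h₀ : ∀ k, φ₀ (Pi.single k 1) ∈ part K (weightHom ω) (intWeight ε) (intWeight ε' k) :=
    fun k => by rw [hφ₀]; exact proj_mem_part _ _
  refine le_antisymm (fun x hx => ?_) fun x hx => mem_initialModule.2 fun W => ?_
  · refine mem_of_forall_proj_mem (U := (LinearMap.ker φ₀).restrictScalars K) (weightHom ω)
      (intWeight ε') fun W => ?_
    obtain ⟨p, hp, hpW, hpx⟩ := mem_initialModule.1 hx W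
    rw [Submodule.restrictScalars_mem, LinearMap.mem_ker, ← hpx, ← proj_map_of_partLE hφ hφ₀ hpW,
      LinearMap.mem_ker.1 hp, map_zero]
  · have hxW : proj (weightHom ω) (intWeight ε') W x ∈
        partLE K (weightHom ω) (intWeight ε') W := part_le_partLE _ (proj_mem_part _ _)
    have hφx := map_mem_partLE (s := 0) (by simpa using hφ) hxW
    rw [add_zero] at hφx
    -- A weight component of a syzygy of the leading parts has an image under `φ` of smaller weight.
    -- A standard representation `t` of that image corrects the component to a true syzygy without
    -- touching its leading part.
    have hlow := mem_partLE_pred hφx (by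
      rw [proj_map_of_partLE hφ hφ₀ hxW, proj_proj, map_proj h₀, LinearMap.mem_ker.1 hx, map_zero])
    obtain ⟨t, htW, ht⟩ := exists_standard_representation_of_range_eq hφ hφ₀ hrange hrange₀
      (hrange ⟨_, rfl⟩) hlow
    refine ⟨proj (weightHom ω) (intWeight ε') W x - t, ?_,
      Submodule.sub_mem _ hxW (partLE_mono (by omega) htW), ?_⟩
    · rw [LinearMap.mem_ker, map_sub, ht, sub_self]
    · rw [map_sub, proj_proj, proj_eq_zero_of_lt htW (by omega), sub_zero]

/-- The division algorithm ends with remainder zero, so a Gröbner-type generating set generates. -/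
theorem range_eq_of_range_leading_eq
    (hφ : ∀ k, φ (Pi.single k 1) ∈ partLE K (weightHom ω) (intWeight ε) (intWeight ε' k))
    (hφ₀ : ∀ k, φ₀ (Pi.single k 1) =
      proj (weightHom ω) (intWeight ε) (intWeight ε' k) (φ (Pi.single k 1)))
    (hrange : LinearMap.range φ ≤ M) (hrange₀ : LinearMap.range φ₀ = initialModule ω ε M) :
    LinearMap.range φ = M := by
  refine le_antisymm hrange fun g hg => ?_
  obtain ⟨v, -, hv⟩ := exists_standard_representation_of_range_eq hφ hφ₀ hrange hrange₀ hg
    (mem_partLE_maxWeight g)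
  exact ⟨v, hv⟩

end LeadingGenerators

/-! ### Lifting the minimal resolution of an initial module -/

section GradedResolutions

variable {K : Type*} [Field K] {n m : ℕ}

/-- A graded free resolution, not necessarily minimal, with prescribed ranks and degrees. -/
structure GradedResolution (rank : ℕ → ℕ) (deg : ∀ i, Fin (rank i) → ℤ) (d : Fin m → ℤ)
    (M : Submodule (MvPolynomial (Fin n) K) (FreeMod K n m)) where
  aug : FreeMod K n (rank 0) →ₗ[MvPolynomial (Fin n) K] FreeMod K n m
  diff : ∀ i, FreeMod K n (rank (i + 1)) →ₗ[MvPolynomial (Fin n) K] FreeMod K n (rank i)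
  aug_mem : ∀ k, aug (Pi.single k 1) ∈ degreePart d (deg 0 k)
  diff_mem : ∀ i k, diff i (Pi.single k 1) ∈ degreePart (deg i) (deg (i + 1) k)
  range_aug : LinearMap.range aug = M
  range_diff_zero : LinearMap.range (diff 0) = LinearMap.ker aug
  range_diff_succ : ∀ i, LinearMap.range (diff (i + 1)) = LinearMap.ker (diff i)

namespace GradedResolution

variable {rank : ℕ → ℕ} {deg : ∀ i, Fin (rank i) → ℤ} {d : Fin m → ℤ}
  {M : Submodule (MvPolynomial (Fin n) K) (FreeMod K n m)}

/-- The differentials have no nonzero constants as matrix entries. -/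
def IsMinimal (R : GradedResolution rank deg d M) : Prop :=
  ∀ i x k, constantCoeff (R.diff i x k) = 0

/-- The resolution of the first syzygy module obtained by dropping the first free module. -/
def tail (R : GradedResolution rank deg d M) :
    GradedResolution (fun i => rank (i + 1)) (fun i => deg (i + 1)) (deg 0)
      (LinearMap.ker R.aug) where
  aug := R.diff 0
  diff i := R.diff (i + 1)
  aug_mem := R.diff_mem 0
  diff_mem i := R.diff_mem (i + 1)
  range_aug := R.range_diff_zero
  range_diff_zero := R.range_diff_succ 0
  range_diff_succ i := R.range_diff_succ (i + 1)

theorem IsMinimal.tail {R : GradedResolution rank deg d M} (hR : R.IsMinimal) :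
    R.tail.IsMinimal := fun i => hR (i + 1)

theorem IsMinimal.constantCoeff_eq_zero {R : GradedResolution rank deg d M} (hR : R.IsMinimal)
    {x : FreeMod K n (rank 0)} (hx : x ∈ LinearMap.ker R.aug) (k : Fin (rank 0)) :
    constantCoeff (x k) = 0 := by
  rw [← R.range_diff_zero] at hx
  obtain ⟨y, rfl⟩ := hx
  exact hR 0 y k

/-- A minimal graded free resolution as an element of `MinimalResolution`. -/
def toMinimalResolution (R : GradedResolution rank deg d M) (hR : R.IsMinimal) :
    MinimalResolution d M where
  rank := rank
  deg := deg
  aug := R.aug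
  diff := R.diff
  aug_mem := R.aug_mem
  diff_mem := R.diff_mem
  range_aug := R.range_aug
  range_diff_zero := R.range_diff_zero
  range_diff_succ := R.range_diff_succ
  minimal i := by
    rintro _ ⟨x, rfl⟩
    exact mem_irrelevantIdeal_smul_top.2 (hR i x)

end GradedResolution

namespace MinimalResolution

variable {d : Fin m → ℤ} {M : Submodule (MvPolynomial (Fin n) K) (FreeMod K n m)}

/-- The graded free resolution underlying a minimal resolution. -/
def toGradedResolution (R : MinimalResolution d M) : GradedResolution R.rank R.deg d M where
  aug := R.aug
  diff := R.diff
  aug_mem := R.aug_mem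
  diff_mem := R.diff_mem
  range_aug := R.range_aug
  range_diff_zero := R.range_diff_zero
  range_diff_succ := R.range_diff_succ

theorem isMinimal_toGradedResolution (R : MinimalResolution d M) :
    R.toGradedResolution.IsMinimal := fun i x =>
  mem_irrelevantIdeal_smul_top.1 (R.minimal i ⟨x, rfl⟩)

end MinimalResolution

/-- A graded submodule of a graded free module whose basis elements also carry weights. -/
structure WeightedSubmodule (K : Type*) [Field K] (n : ℕ) where
  rank : ℕ
  deg : Fin rank → ℤ
  wt : Fin rank → ℕ
  sub : Submodule (MvPolynomial (Fin n) K) (FreeMod K n rank)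
  graded : IsGraded deg sub

/-- One step of the lifting. The new basis elements receive the maximal weights of the chosen
generators, and for these weights taking syzygies commutes with taking initial modules. The output
has the same form as the input, so the step can be iterated. -/
theorem WeightedSubmodule.exists_syzygies (ω : Fin n → ℕ) (X : WeightedSubmodule K n) :
    ∃ (Y : WeightedSubmodule K n)
      (φ φ₀ : FreeMod K n Y.rank →ₗ[MvPolynomial (Fin n) K] FreeMod K n X.rank),
      (∀ k, φ (Pi.single k 1) ∈ degreePart X.deg (Y.deg k)) ∧
      (∀ k, φ₀ (Pi.single k 1) = initialPart ω X.wt (φ (Pi.single k 1))) ∧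
      LinearMap.range φ = X.sub ∧
      LinearMap.range φ₀ = initialModule ω X.wt X.sub ∧
      LinearMap.ker φ = Y.sub ∧
      LinearMap.ker φ₀ = initialModule ω Y.wt Y.sub ∧
      ∀ c ∈ LinearMap.ker φ₀, ∀ k, constantCoeff (c k) = 0 := by
  obtain ⟨r, f, d', hf, hrange₀, hmin⟩ := exists_leading_generators ω X.wt X.graded
  set φ := Fintype.linearCombination (MvPolynomial (Fin n) K) f with hφ_def
  set φ₀ := Fintype.linearCombination (MvPolynomial (Fin n) K)
    fun k => initialPart ω X.wt (f k) with hφ₀_def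
  have hφf : ∀ k, φ (Pi.single k 1) = f k := fun k => by
    rw [hφ_def, Fintype.linearCombination_apply_single, one_smul]
  have hφ₀f : ∀ k, φ₀ (Pi.single k 1) = initialPart ω X.wt (f k) := fun k => by
    rw [hφ₀_def, Fintype.linearCombination_apply_single, one_smul]
  have hφd : ∀ k, φ (Pi.single k 1) ∈ part K (degHom n) X.deg (d' k) := fun k => by
    rw [hφf]
    exact (mem_gradedPiece.1 (hf k)).2
  have hφ : ∀ k, φ (Pi.single k 1) ∈ partLE K (weightHom ω) (intWeight X.wt)
      (intWeight (fun k => maxWeight ω X.wt (f k)) k) := fun k => by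
    rw [hφf]
    exact mem_partLE_maxWeight _
  have hφ₀ : ∀ k, φ₀ (Pi.single k 1) = proj (weightHom ω) (intWeight X.wt)
      (intWeight (fun k => maxWeight ω X.wt (f k)) k) (φ (Pi.single k 1)) := fun k => by
    rw [hφ₀f, hφf]
    exact initialPart_eq_proj _
  have hrange : LinearMap.range φ ≤ X.sub := by
    rw [hφ_def, Fintype.range_linearCombination, Submodule.span_le]
    rintro _ ⟨k, rfl⟩
    exact (mem_gradedPiece.1 (hf k)).1
  refine ⟨⟨r, d', fun k => maxWeight ω X.wt (f k), LinearMap.ker φ, isGraded_ker hφd⟩, φ, φ₀, hφd,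
    fun k => by rw [hφ₀f, hφf], range_eq_of_range_leading_eq hφ hφ₀ hrange hrange₀, hrange₀, rfl,
    (initialModule_ker hφ hφ₀ hrange hrange₀).symm, hmin⟩

variable {d : Fin m → ℤ} {M : Submodule (MvPolynomial (Fin n) K) (FreeMod K n m)}

/-- The minimal graded free resolution of an initial module lifts to a graded free resolution of
the module, with the same ranks and degrees. -/
theorem exists_lifted_resolution (ω : Fin n → ℕ) (ε : Fin m → ℕ) (hM : IsGraded d M) :
    ∃ (rank : ℕ → ℕ) (deg : ∀ i, Fin (rank i) → ℤ) (R : GradedResolution rank deg d M)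
      (R₀ : GradedResolution rank deg d (initialModule ω ε M)), R₀.IsMinimal ∧
      ∀ k, R₀.aug (Pi.single k 1) = initialPart ω ε (R.aug (Pi.single k 1)) := by
  choose next φ φ₀ h₁ h₂ h₃ h₄ h₅ h₆ h₇ using
    WeightedSubmodule.exists_syzygies (K := K) (n := n) ω
  let X₀ : WeightedSubmodule K n := ⟨m, d, ε, M, hM⟩
  let X : ℕ → WeightedSubmodule K n := fun i => Nat.rec X₀ (fun _ Y => next Y) i
  have h₁' : ∀ (X : WeightedSubmodule K n) k,
      φ₀ X (Pi.single k 1) ∈ degreePart X.deg ((next X).deg k) := fun X k => by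
    rw [h₂]
    exact initialPart_mem_part (h₁ X k)
  refine ⟨fun i => (X (i + 1)).rank, fun i => (X (i + 1)).deg,
    { aug := φ X₀
      diff := fun i => φ (X (i + 1))
      aug_mem := h₁ X₀
      diff_mem := fun i => h₁ (X (i + 1))
      range_aug := h₃ X₀
      range_diff_zero := (h₃ (X 1)).trans (h₅ X₀).symm
      range_diff_succ := fun i => (h₃ (X (i + 2))).trans (h₅ (X (i + 1))).symm },
    { aug := φ₀ X₀
      diff := fun i => φ₀ (X (i + 1))
      aug_mem := h₁' X₀
      diff_mem := fun i => h₁' (X (i + 1))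
      range_aug := h₄ X₀
      range_diff_zero := (h₄ (X 1)).trans (h₆ X₀).symm
      range_diff_succ := fun i => (h₄ (X (i + 2))).trans (h₆ (X (i + 1))).symm }, ?_, h₂ X₀⟩
  -- The image of each differential consists of syzygies of a minimal system of leading parts, and
  -- these have no constant coefficients.
  intro i x k
  have hx : φ₀ (X (i + 1)) x ∈ LinearMap.ker (φ₀ (X i)) := by
    rw [h₆]
    exact (h₄ (X (i + 1))).le ⟨x, rfl⟩
  exact h₇ (X i) _ hx k

theorem nonempty_minimalResolution_initialModule (ω : Fin n → ℕ) (ε : Fin m → ℕ)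
    (hM : IsGraded d M) : Nonempty (MinimalResolution d (initialModule ω ε M)) := by
  obtain ⟨_, _, _, R₀, hR₀, _⟩ := exists_lifted_resolution ω ε hM
  exact ⟨R₀.toMinimalResolution hR₀⟩

/-- With zero weights every element is its own initial part. The lifting theorem then yields the
existence of minimal resolutions. -/
theorem initialModule_zero_weights : initialModule (fun _ => 0) (fun _ => 0) M = M := by
  refine initialModule_eq_self fun x hx W => ?_
  have hpart : x ∈ part K (weightHom fun _ => 0) (intWeight fun _ => 0) 0 := fun j u _ => by
    simp [weightHom, intWeight]
  rw [proj_of_mem_part hpart]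
  split_ifs
  · exact hx
  · exact M.zero_mem

/-- Graded submodules have minimal graded free resolutions. -/
theorem nonempty_minimalResolution (hM : IsGraded d M) : Nonempty (MinimalResolution d M) := by
  have := nonempty_minimalResolution_initialModule (fun _ => 0) (fun _ => 0) hM
  rwa [initialModule_zero_weights] at this

end GradedResolutions

/-! ### Comparison of a minimal resolution with an arbitrary one, modulo 𝔪 -/

section Comparison

variable {K : Type*} [Field K] {n a b c : ℕ}

/-- The reduction of a map of free modules modulo the irrelevant ideal. -/
noncomputable def residue (f : FreeMod K n a →ₗ[MvPolynomial (Fin n) K] FreeMod K n b) :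
    (Fin a → K) →ₗ[K] (Fin b → K) where
  toFun x j := constantCoeff (f (fun k => C (x k)) j)
  map_add' x y := by
    have : (fun k => C (x k + y k) : FreeMod K n a) = (fun k => C (x k)) + fun k => C (y k) :=
      funext fun k => C_add
    ext j
    change constantCoeff (f (fun k => C (x k + y k)) j) = _
    rw [this, map_add, Pi.add_apply, map_add]
    rfl
  map_smul' t x := by
    have : (fun k => C (t * x k) : FreeMod K n a) =
        (C t : MvPolynomial (Fin n) K) • fun k => C (x k) := funext fun k => C_mul
    ext j
    change constantCoeff (f (fun k => C (t * x k)) j) = _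
    rw [this, map_smul, Pi.smul_apply, smul_eq_mul, map_mul, constantCoeff_C]
    rfl

theorem residue_apply (f : FreeMod K n a →ₗ[MvPolynomial (Fin n) K] FreeMod K n b)
    (x : Fin a → K) (j : Fin b) : residue f x j = constantCoeff (f (fun k => C (x k)) j) := rfl

/-- Maps of free modules preserve the vanishing of all constant coefficients. -/
theorem constantCoeff_map_eq_zero (f : FreeMod K n a →ₗ[MvPolynomial (Fin n) K] FreeMod K n b)
    {y : FreeMod K n a} (hy : ∀ k, constantCoeff (y k) = 0) (j : Fin b) :
    constantCoeff (f y j) = 0 := by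
  rw [linearMap_eq_sum, Finset.sum_apply, map_sum]
  exact Finset.sum_eq_zero fun k _ => by simp [hy k]

theorem residue_constantCoeff (f : FreeMod K n a →ₗ[MvPolynomial (Fin n) K] FreeMod K n b)
    (y : FreeMod K n a) (j : Fin b) :
    residue f (fun k => constantCoeff (y k)) j = constantCoeff (f y j) := by
  have := constantCoeff_map_eq_zero f (y := (fun k => C (constantCoeff (y k))) - y)
    (fun k => by simp) j
  rw [map_sub, Pi.sub_apply, map_sub, sub_eq_zero] at this
  exact this

theorem residue_injective_of_retraction
    {f : FreeMod K n a →ₗ[MvPolynomial (Fin n) K] FreeMod K n b}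
    {g : FreeMod K n b →ₗ[MvPolynomial (Fin n) K] FreeMod K n a}
    (h : ∀ x k, constantCoeff (g (f x) k) = constantCoeff (x k)) :
    Function.Injective (residue f) := by
  refine Function.LeftInverse.injective (g := residue g) fun x => ?_
  ext k
  change residue g (fun j => constantCoeff (f (fun k => C (x k)) j)) k = x k
  rw [residue_constantCoeff, h, constantCoeff_C]

/-- A nonzero constant entry contributes a term of degree `l' j` to a column that is homogeneous of
degree `l k`. -/
theorem residue_single_ne_zero {l : Fin a → ℤ} {l' : Fin b → ℤ}
    {f : FreeMod K n a →ₗ[MvPolynomial (Fin n) K] FreeMod K n b}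
    (hf : ∀ k, f (Pi.single k 1) ∈ part K (degHom n) l' (l k)) {k : Fin a} {j : Fin b}
    (h : residue f (Pi.single k 1) j ≠ 0) : l' j = l k := by
  have hC : (fun i => C ((Pi.single k 1 : Fin a → K) i) : FreeMod K n a) = Pi.single k 1 := by
    ext1 i
    by_cases hi : i = k
    · subst hi; simp
    · simp [hi]
  rw [residue_apply, hC] at h
  have : degHom n 0 + l' j = l k := hf k j 0 h
  rwa [map_zero, zero_add] at this

theorem exists_lift {f : FreeMod K n a →ₗ[MvPolynomial (Fin n) K] FreeMod K n c}
    {g : FreeMod K n b →ₗ[MvPolynomial (Fin n) K] FreeMod K n c}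
    (h : ∀ x, f x ∈ LinearMap.range g) :
    ∃ t : FreeMod K n a →ₗ[MvPolynomial (Fin n) K] FreeMod K n b, ∀ x, g (t x) = f x := by
  choose y hy using fun k => h (Pi.single k 1)
  refine ⟨Fintype.linearCombination _ y, fun x => ?_⟩
  rw [Fintype.linearCombination_apply, map_sum, linearMap_eq_sum f]
  exact Finset.sum_congr rfl fun k _ => by rw [map_smul, hy]

theorem exists_homogeneous_lift {la : Fin a → ℤ} {lb : Fin b → ℤ} {lc : Fin c → ℤ}
    {f : FreeMod K n a →ₗ[MvPolynomial (Fin n) K] FreeMod K n c}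
    {g : FreeMod K n b →ₗ[MvPolynomial (Fin n) K] FreeMod K n c}
    (hf : ∀ k, f (Pi.single k 1) ∈ part K (degHom n) lc (la k))
    (hg : ∀ k, g (Pi.single k 1) ∈ part K (degHom n) lc (lb k))
    (h : ∀ x, f x ∈ LinearMap.range g) :
    ∃ t : FreeMod K n a →ₗ[MvPolynomial (Fin n) K] FreeMod K n b, (∀ x, g (t x) = f x) ∧
      ∀ k, t (Pi.single k 1) ∈ part K (degHom n) lb (la k) := by
  choose y hy using fun k => h (Pi.single k 1)
  refine ⟨Fintype.linearCombination _ fun k => proj (degHom n) lb (la k) (y k),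
    fun x => ?_, fun k => ?_⟩
  · rw [Fintype.linearCombination_apply, map_sum, linearMap_eq_sum f]
    exact Finset.sum_congr rfl fun k _ => by rw [map_smul, map_proj hg, hy, proj_eq_self (hf k)]
  · rw [Fintype.linearCombination_apply_single, one_smul]
    exact proj_mem_part _ _

/-- Maps between two submodules of free modules, the first of which is homogeneous, whose
composition is the identity of `T` up to a map that is divisible by the irrelevant ideal. -/
structure ResidualRetraction (d : Fin a → ℤ) (T : Submodule (MvPolynomial (Fin n) K) (FreeMod K n a))
    (d' : Fin b → ℤ) (S : Submodule (MvPolynomial (Fin n) K) (FreeMod K n b)) where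
  incl : FreeMod K n a →ₗ[MvPolynomial (Fin n) K] FreeMod K n b
  retr : FreeMod K n b →ₗ[MvPolynomial (Fin n) K] FreeMod K n a
  err : FreeMod K n a →ₗ[MvPolynomial (Fin n) K] FreeMod K n a
  incl_mem : ∀ x ∈ T, incl x ∈ S
  incl_mem_part : ∀ k, incl (Pi.single k 1) ∈ part K (degHom n) d' (d k)
  retr_mem : ∀ x ∈ S, retr x ∈ T
  err_mem : ∀ x, err x ∈ T
  retr_incl : ∀ x ∈ T, retr (incl x) = x + err x
  err_mem_smul : ∀ x ∈ T, err x ∈ irrelevantIdeal K n • T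

theorem single_mem_part (d : Fin a → ℤ) (k : Fin a) :
    (Pi.single k 1 : FreeMod K n a) ∈ part K (degHom n) d (d k) := by
  intro j u h
  by_cases hj : j = k
  · subst hj
    rw [Pi.single_eq_same, coeff_one, ne_eq, ite_eq_right_iff, not_forall] at h
    obtain ⟨rfl, -⟩ := h
    rw [map_zero, zero_add]
  · rw [Pi.single_eq_of_ne hj, coeff_zero] at h
    exact absurd rfl h

/-- The identity of a submodule. -/
noncomputable def ResidualRetraction.refl (d : Fin a → ℤ)
    (T : Submodule (MvPolynomial (Fin n) K) (FreeMod K n a)) : ResidualRetraction d T d T where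
  incl := LinearMap.id
  retr := LinearMap.id
  err := 0
  incl_mem _ := id
  incl_mem_part := single_mem_part d
  retr_mem _ := id
  err_mem _ := T.zero_mem
  retr_incl x _ := (add_zero x).symm
  err_mem_smul _ _ := Submodule.zero_mem _

/-- Maps that are mutually inverse modulo the irrelevant ideal lift to free covers, the first of
which is minimal. -/
theorem ResidualRetraction.exists_lift {d : Fin a → ℤ} {d' : Fin b → ℤ}
    {T : Submodule (MvPolynomial (Fin n) K) (FreeMod K n a)}
    {S : Submodule (MvPolynomial (Fin n) K) (FreeMod K n b)} (D : ResidualRetraction d T d' S)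
    {p q : ℕ} {e : Fin p → ℤ} {e' : Fin q → ℤ}
    {π : FreeMod K n p →ₗ[MvPolynomial (Fin n) K] FreeMod K n a}
    {π' : FreeMod K n q →ₗ[MvPolynomial (Fin n) K] FreeMod K n b}
    (hπ : ∀ k, π (Pi.single k 1) ∈ part K (degHom n) d (e k))
    (hπ' : ∀ k, π' (Pi.single k 1) ∈ part K (degHom n) d' (e' k))
    (hT : LinearMap.range π = T) (hS : LinearMap.range π' = S)
    (hmin : ∀ x ∈ LinearMap.ker π, ∀ k, constantCoeff (x k) = 0) :
    ∃ D' : ResidualRetraction e (LinearMap.ker π) e' (LinearMap.ker π'),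
      (∀ x, π' (D'.incl x) = D.incl (π x)) ∧ Function.Injective (residue D'.incl) := by
  have hπT : ∀ x, π x ∈ T := fun x => hT ▸ ⟨x, rfl⟩
  have hπ'S : ∀ x, π' x ∈ S := fun x => hS ▸ ⟨x, rfl⟩
  obtain ⟨α, hα, hαd⟩ := exists_homogeneous_lift (f := D.incl ∘ₗ π) (g := π') (la := e)
    (fun k => map_mem_part D.incl_mem_part (hπ k)) hπ' (fun x => by
      rw [hS]; exact D.incl_mem _ (hπT x))
  obtain ⟨β, hβ⟩ := GradedFree.exists_lift (f := D.retr ∘ₗ π') (g := π) (fun x => by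
    rw [hT]; exact D.retr_mem _ (hπ'S x))
  obtain ⟨t, ht⟩ := GradedFree.exists_lift (f := D.err) (g := π) (fun x => by
    rw [hT]; exact D.err_mem x)
  simp only [LinearMap.comp_apply] at hα hβ
  let err : FreeMod K n p →ₗ[MvPolynomial (Fin n) K] FreeMod K n p :=
    β ∘ₗ α - LinearMap.id - t ∘ₗ π
  have herr : ∀ x, err x = β (α x) - x - t (π x) := fun x => rfl
  have herr_mem : ∀ x, err x ∈ LinearMap.ker π := fun x => by
    rw [LinearMap.mem_ker, herr, map_sub, map_sub, hβ, hα, ht, D.retr_incl _ (hπT x)]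
    abel
  -- The error on `T` lies in 𝔪T = π(𝔪F), so `t (π x)` differs from an element of 𝔪F by an element
  -- of the kernel, which has no constant terms by minimality.
  have htπ : ∀ x k, constantCoeff (t (π x) k) = 0 := by
    intro x k
    have hmap : irrelevantIdeal K n • T = (irrelevantIdeal K n • ⊤ : Submodule _ _).map π := by
      rw [Submodule.map_smul'', ← LinearMap.range_eq_map, hT]
    obtain ⟨y, hy, hyx⟩ := hmap.le (D.err_mem_smul _ (hπT x))
    have h₂ := hmin (t (π x) - y) (by rw [LinearMap.mem_ker, map_sub, ht, hyx, sub_self]) k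
    rwa [Pi.sub_apply, map_sub, mem_irrelevantIdeal_smul_top.1 hy k, sub_zero] at h₂
  refine ⟨⟨α, β, err, fun x hx => ?_, hαd, fun x hx => ?_, herr_mem, fun x hx => ?_,
    fun x hx => ?_⟩, hα, residue_injective_of_retraction (g := β) fun x k => ?_⟩
  · rw [LinearMap.mem_ker, hα, LinearMap.mem_ker.1 hx, map_zero]
  · rw [LinearMap.mem_ker, hβ, LinearMap.mem_ker.1 hx, map_zero]
  · rw [herr, LinearMap.mem_ker.1 hx, map_zero]
    abel
  -- By minimality the kernel lies in 𝔪F. As `err` sends all of F into the kernel, it sends 𝔪F into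
  -- 𝔪 times the kernel.
  · have h₁ := Submodule.mem_map_of_mem (f := err) (mem_irrelevantIdeal_smul_top.2 (hmin x hx))
    rw [Submodule.map_smul''] at h₁
    refine Submodule.smul_mono le_rfl ?_ h₁
    rintro _ ⟨y, -, rfl⟩
    exact herr_mem y
  · have h₁ := hmin _ (herr_mem x) k
    rw [herr, Pi.sub_apply, Pi.sub_apply, map_sub, map_sub, htπ, sub_zero, sub_eq_zero] at h₁
    exact h₁

variable {rank rank' : ℕ → ℕ} {deg : ∀ i, Fin (rank i) → ℤ} {deg' : ∀ i, Fin (rank' i) → ℤ}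

/-- Passing to kernels turns a residual retraction into another one, so induction moves along the
tails of both resolutions. Only `R` has to be minimal. -/
theorem ResidualRetraction.exists_chain_map (i : ℕ) {a b : ℕ} {rank rank' : ℕ → ℕ}
    {deg : ∀ i, Fin (rank i) → ℤ} {deg' : ∀ i, Fin (rank' i) → ℤ}
    {d : Fin a → ℤ} {d' : Fin b → ℤ}
    {T : Submodule (MvPolynomial (Fin n) K) (FreeMod K n a)}
    {S : Submodule (MvPolynomial (Fin n) K) (FreeMod K n b)} (D : ResidualRetraction d T d' S)
    (R : GradedResolution rank deg d T) (hR : R.IsMinimal) (R' : GradedResolution rank' deg' d' S) :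
    ∃ (α : FreeMod K n (rank i) →ₗ[MvPolynomial (Fin n) K] FreeMod K n (rank' i))
      (α' : FreeMod K n (rank (i + 1)) →ₗ[MvPolynomial (Fin n) K] FreeMod K n (rank' (i + 1))),
      (∀ k, α (Pi.single k 1) ∈ part K (degHom n) (deg' i) (deg i k)) ∧
      (∀ x, R'.diff i (α' x) = α (R.diff i x)) ∧
      Function.Injective (residue α) ∧ Function.Injective (residue α') := by
  induction i generalizing a b rank rank' deg deg' d d' T S with
  | zero =>
    obtain ⟨D₁, -, h₁⟩ := D.exists_lift R.aug_mem R'.aug_mem R.range_aug R'.range_aug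
      fun x hx => hR.constantCoeff_eq_zero hx
    obtain ⟨D₂, h₂, h₃⟩ := D₁.exists_lift (R.diff_mem 0) (R'.diff_mem 0) R.range_diff_zero
      R'.range_diff_zero fun x hx => hR.tail.constantCoeff_eq_zero hx
    exact ⟨D₁.incl, D₂.incl, D₁.incl_mem_part, h₂, h₁, h₃⟩
  | succ i ih =>
    obtain ⟨D₁, -, -⟩ := D.exists_lift R.aug_mem R'.aug_mem R.range_aug R'.range_aug
      fun x hx => hR.constantCoeff_eq_zero hx
    exact ih D₁ R.tail hR.tail R'.tail

variable {d : Fin a → ℤ} {M : Submodule (MvPolynomial (Fin n) K) (FreeMod K n a)}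

theorem GradedResolution.IsMinimal.exists_chain_map {R : GradedResolution rank deg d M}
    (hR : R.IsMinimal) (R' : GradedResolution rank' deg' d M) (i : ℕ) :
    ∃ (α : FreeMod K n (rank i) →ₗ[MvPolynomial (Fin n) K] FreeMod K n (rank' i))
      (α' : FreeMod K n (rank (i + 1)) →ₗ[MvPolynomial (Fin n) K] FreeMod K n (rank' (i + 1))),
      (∀ k, α (Pi.single k 1) ∈ part K (degHom n) (deg' i) (deg i k)) ∧
      (∀ x, R'.diff i (α' x) = α (R.diff i x)) ∧
      Function.Injective (residue α) ∧ Function.Injective (residue α') :=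
  (ResidualRetraction.refl d M).exists_chain_map i R hR R'

/-- The degrees in a minimal resolution occur in every resolution. -/
theorem GradedResolution.IsMinimal.exists_deg_eq {R : GradedResolution rank deg d M}
    (hR : R.IsMinimal) (R' : GradedResolution rank' deg' d M) (i : ℕ) (k : Fin (rank i)) :
    ∃ k', deg' i k' = deg i k := by
  obtain ⟨α, -, hα, -, hinj, -⟩ := hR.exists_chain_map R' i
  have hne : residue α (Pi.single k 1) ≠ 0 := fun h => by
    have := hinj (h.trans (map_zero _).symm)
    simp at this
  obtain ⟨k', hk'⟩ := Function.ne_iff.1 hne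
  exact ⟨k', residue_single_ne_zero hα hk'⟩

/-- The ranks in a minimal resolution are at most those in any resolution. -/
theorem GradedResolution.IsMinimal.rank_le {R : GradedResolution rank deg d M}
    (hR : R.IsMinimal) (R' : GradedResolution rank' deg' d M) (i : ℕ) : rank i ≤ rank' i := by
  obtain ⟨α, -, -, -, hinj, -⟩ := hR.exists_chain_map R' i
  have := LinearMap.finrank_le_finrank_of_injective hinj
  rwa [Module.finrank_fin_fun, Module.finrank_fin_fun] at this

/-- If a resolution has the same rank in homological degree `i + 1` as the minimal one, then its
`i`-th differential is minimal. -/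
theorem GradedResolution.IsMinimal.constantCoeff_diff_eq_zero {R : GradedResolution rank deg d M}
    (hR : R.IsMinimal) (R' : GradedResolution rank' deg' d M) {i : ℕ}
    (h : rank (i + 1) = rank' (i + 1)) (x : FreeMod K n (rank' (i + 1))) (k : Fin (rank' i)) :
    constantCoeff (R'.diff i x k) = 0 := by
  obtain ⟨α, α', -, hcomm, -, hinj⟩ := hR.exists_chain_map R' i
  -- Equal ranks make the injective residue bijective, so modulo 𝔪 each `x` comes from the minimal
  -- resolution, whose differential is zero modulo 𝔪.
  have hsurj : Function.Surjective (residue α') :=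
    (LinearMap.injective_iff_surjective_of_finrank_eq_finrank (by
      rw [Module.finrank_fin_fun, Module.finrank_fin_fun, h])).1 hinj
  obtain ⟨y, hy⟩ := hsurj fun j => constantCoeff (x j)
  have hy' : ∀ j, constantCoeff (α' (fun k => C (y k)) j) = constantCoeff (x j) := congrFun hy
  have h₁ := constantCoeff_map_eq_zero (R'.diff i) (y := x - α' fun k => C (y k))
    (fun j => by rw [Pi.sub_apply, map_sub, hy', sub_self]) k
  rw [map_sub, Pi.sub_apply, map_sub, sub_eq_zero, hcomm] at h₁
  rw [h₁]
  exact constantCoeff_map_eq_zero α (hR i _) k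

end Comparison

/-! ### Regularity bounds and Buchberger's criterion for the modules M_⟨a⟩ -/

section ComponentwiseLinear

variable {K : Type*} [Field K] {n m : ℕ} {d : Fin m → ℤ}
  {M : Submodule (MvPolynomial (Fin n) K) (FreeMod K n m)}
  {rank : ℕ → ℕ} {deg : ∀ i, Fin (rank i) → ℤ}

/-- `gradedBetti` reads off an arbitrarily chosen minimal resolution; the degrees of `R` occur there
because `R` is minimal. -/
theorem deg_le_of_regularity_le {R : GradedResolution rank deg d M} (hR : R.IsMinimal) {a : ℤ}
    (h : regularity d M ≤ ((a : WithTop ℤ) : WithBot (WithTop ℤ))) (i : ℕ) (k : Fin (rank i)) :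
    deg i k ≤ a + i := by
  have hne : Nonempty (MinimalResolution d M) := ⟨R.toMinimalResolution hR⟩
  obtain ⟨k', hk'⟩ := hR.exists_deg_eq hne.some.toGradedResolution i k
  have hb : gradedBetti d M i (deg i k) ≠ 0 := by
    rw [gradedBetti, dif_pos hne, Finset.card_ne_zero]
    exact ⟨k', Finset.mem_filter.2 ⟨Finset.mem_univ _, hk'⟩⟩
  have h₁ := (le_iSup_of_le i (le_iSup_of_le (deg i k) (le_iSup_of_le hb le_rfl))).trans h
  rw [WithBot.coe_le_coe, WithTop.coe_le_coe] at h₁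
  omega

/-- `R` need not be minimal, since the degrees of the chosen minimal resolution occur among those of
`R`. A lifted resolution therefore suffices. -/
theorem regularity_le_of_deg_le (R : GradedResolution rank deg d M) {a : ℤ}
    (h : ∀ i k, deg i k ≤ a + i) :
    regularity d M ≤ ((a : WithTop ℤ) : WithBot (WithTop ℤ)) := by
  refine iSup_le fun i => iSup_le fun j => iSup_le fun hb => ?_
  rw [gradedBetti] at hb
  split_ifs at hb with hne
  · obtain ⟨k, hk⟩ := Finset.card_ne_zero.1 hb
    obtain ⟨k', hk'⟩ := hne.some.isMinimal_toGradedResolution.exists_deg_eq R i k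
    have h₁ := h i k'
    rw [hk', (Finset.mem_filter.1 hk).2] at h₁
    rw [WithBot.coe_le_coe, WithTop.coe_le_coe]
    omega
  · exact absurd rfl hb

theorem betti_eq_rank {R : GradedResolution rank deg d M} (hR : R.IsMinimal) (i : ℕ) :
    betti d M i = rank i := by
  have hne : Nonempty (MinimalResolution d M) := ⟨R.toMinimalResolution hR⟩
  rw [betti, dif_pos hne]
  exact le_antisymm (hne.some.isMinimal_toGradedResolution.rank_le R i)
    (hR.rank_le hne.some.toGradedResolution i)

theorem generatedInDegree_le (a : ℤ) : generatedInDegree d M a ≤ M :=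
  Submodule.span_le.2 fun _ hx => (mem_gradedPiece.1 hx).1

theorem gradedPiece_subset_generatedInDegree {a : ℤ} {x : FreeMod K n m}
    (hx : x ∈ gradedPiece d M a) : x ∈ generatedInDegree d M a := Submodule.subset_span hx

/-- In a combination of generators of degree `a`, only monomial coefficients of degree `b - a`
survive projection to degree `b`. -/
theorem mem_of_mem_generatedInDegree {a b : ℤ} {g : FreeMod K n m}
    (hg : g ∈ gradedPiece d (generatedInDegree d M a) b) (U : Submodule K (FreeMod K n m))
    (hU : ∀ (u : Fin n →₀ ℕ) (x : K), degHom n u + a = b →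
      ∀ v ∈ gradedPiece d M a, monomial u x • v ∈ U) : g ∈ U := by
  -- `U` need not be stable under monomials; quantifying over all monomial multiples gives a
  -- subspace that is.
  let U' : Submodule K (FreeMod K n m) :=
    { carrier := {g | ∀ (u : Fin n →₀ ℕ) (x : K), proj (degHom n) d b (monomial u x • g) ∈ U}
      zero_mem' := fun u x => by rw [smul_zero, map_zero]; exact U.zero_mem
      add_mem' := fun hf hg u x => by rw [smul_add, map_add]; exact U.add_mem (hf u x) (hg u x)
      smul_mem' := fun c f hf u x => by rw [smul_comm, map_smul]; exact U.smul_mem c (hf u x) }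
  have hgU' : g ∈ U' := by
    refine Submodule.span_induction (p := fun x _ => x ∈ U') ?_ U'.zero_mem
      (fun x y _ _ hx hy => U'.add_mem hx hy)
      (fun q x _ hx => smul_mem_of_monomial_smul_mem U' ?_ q hx) (mem_gradedPiece.1 hg).1
    · intro v hv u x
      rw [proj_of_mem_part (monomial_smul_mem_part (mem_gradedPiece.1 hv).2 u x)]
      split_ifs with h
      · exact hU u x h.symm v hv
      · exact U.zero_mem
    · intro u x f hf u' x'
      have := hf (u' + u) (x' * x)
      rwa [← monomial_mul, ← smul_smul] at this
  have := hgU' 0 1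
  rwa [show (monomial 0 1 : MvPolynomial (Fin n) K) = 1 from rfl, one_smul,
    proj_eq_self (mem_gradedPiece.1 hg).2] at this

theorem eq_zero_of_mem_generatedInDegree_of_lt {a b : ℤ} (hab : b < a) {g : FreeMod K n m}
    (hg : g ∈ gradedPiece d (generatedInDegree d M a) b) : g = 0 := by
  refine (Submodule.mem_bot K).1 (mem_of_mem_generatedInDegree hg ⊥ fun u x h => ?_)
  have := degHom_nonneg u
  omega

theorem mem_irrelevantIdeal_smul_of_lt {a b : ℤ} (hab : a < b) {g : FreeMod K n m}
    (hg : g ∈ gradedPiece d (generatedInDegree d M a) b) : g ∈ irrelevantIdeal K n • M := by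
  refine mem_of_mem_generatedInDegree hg ((irrelevantIdeal K n • M).restrictScalars K)
    fun u x h v hv => ?_
  rw [Submodule.restrictScalars_mem]
  refine Submodule.smul_mem_smul (mem_irrelevantIdeal_iff.2 ?_) (mem_gradedPiece.1 hv).1
  rw [constantCoeff_monomial, if_neg]
  rintro rfl
  rw [map_zero] at h
  omega

/-- Splitting one variable off `u` leaves a multiple of `h` of degree exactly `a`. -/
theorem monomial_smul_mem_generatedInDegree {a b : ℤ} {h : FreeMod K n m}
    (hh : h ∈ gradedPiece d M b) {u : Fin n →₀ ℕ} (hu : u ≠ 0) (hub : degHom n u + b = a + 1)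
    (x : K) : monomial u x • h ∈ generatedInDegree d M a := by
  obtain ⟨i, hi⟩ := Finsupp.ne_iff.1 hu
  obtain ⟨w, rfl⟩ : ∃ w, u = Finsupp.single i 1 + w := by
    refine exists_add_of_le ?_
    rw [Finsupp.single_le_iff]
    exact Nat.one_le_iff_ne_zero.2 hi
  have h1 : degHom n (Finsupp.single i 1) = 1 := by simp [degHom]
  rw [← one_mul x, ← monomial_mul, ← smul_smul]
  refine Submodule.smul_mem _ _ (gradedPiece_subset_generatedInDegree
    (mem_gradedPiece.2 ⟨M.smul_mem _ (mem_gradedPiece.1 hh).1, ?_⟩))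
  have := monomial_smul_mem_part (mem_gradedPiece.1 hh).2 w x
  rw [map_add, h1] at hub
  rwa [show degHom n w + b = a by omega] at this

variable {ω : Fin n → ℕ} {ε : Fin m → ℕ}

/-- If the generators of `M` obtained by lifting minimal generators of the initial module are
themselves minimal, then the leading components of elements of degree `a + 1` of `M_⟨a⟩` lie in
the submodule generated by the elements of degree `a` of the initial module. -/
theorem proj_mem_generatedInDegree_initialModule
    (R : GradedResolution rank deg d M) (R₀ : GradedResolution rank deg d (initialModule ω ε M))
    (hR₀ : ∀ k, R₀.aug (Pi.single k 1) = initialPart ω ε (R.aug (Pi.single k 1)))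
    (hker : ∀ c ∈ LinearMap.ker R.aug, ∀ k, constantCoeff (c k) = 0) {a : ℤ} {g : FreeMod K n m}
    (hg : g ∈ gradedPiece d (generatedInDegree d M a) (a + 1)) {W : ℤ}
    (hgW : g ∈ partLE K (weightHom ω) (intWeight ε) W) :
    proj (weightHom ω) (intWeight ε) W g ∈ generatedInDegree d (initialModule ω ε M) a := by
  have hφ : ∀ k, R.aug (Pi.single k 1) ∈ partLE K (weightHom ω) (intWeight ε)
      (intWeight (fun k => maxWeight ω ε (R.aug (Pi.single k 1))) k) := fun k =>
    mem_partLE_maxWeight _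
  have hφ₀ : ∀ k, R₀.aug (Pi.single k 1) = proj (weightHom ω) (intWeight ε)
      (intWeight (fun k => maxWeight ω ε (R.aug (Pi.single k 1))) k) (R.aug (Pi.single k 1)) :=
    fun k => (hR₀ k).trans (initialPart_eq_proj _)
  have hgM : g ∈ gradedPiece d M (a + 1) :=
    mem_gradedPiece.2 ⟨generatedInDegree_le a (mem_gradedPiece.1 hg).1, (mem_gradedPiece.1 hg).2⟩
  obtain ⟨c, hcd, hcW, hcg⟩ := exists_homogeneous_standard_representation (M := M) hφ hφ₀ R.aug_mem
    R.range_aug.le (fun g hg W hgW => by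
      rw [R₀.range_aug]
      exact proj_mem_initialModule (mem_gradedPiece.1 hg).1 hgW) hgM hgW
  -- `g` lies in 𝔪M, so it also has a representation with coefficients in 𝔪. The two differ by a
  -- syzygy, which has no constant terms by `hker`.
  have hc : ∀ k, constantCoeff (c k) = 0 := by
    intro k
    have hmap : irrelevantIdeal K n • M = (irrelevantIdeal K n • ⊤ : Submodule _ _).map R.aug := by
      rw [Submodule.map_smul'', ← LinearMap.range_eq_map, R.range_aug]
    obtain ⟨y, hy, hyg⟩ := hmap.le (mem_irrelevantIdeal_smul_of_lt (lt_add_one a) hg)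
    have := hker (c - y) (by rw [LinearMap.mem_ker, map_sub, hcg, hyg, sub_self]) k
    rwa [Pi.sub_apply, map_sub, mem_irrelevantIdeal_smul_top.1 hy, sub_zero] at this
  rw [← hcg, proj_map_of_partLE hφ hφ₀ hcW]
  refine linearMap_mem_of_monomial R₀.aug
    ((generatedInDegree d (initialModule ω ε M) a).restrictScalars K) fun k u hu => ?_
  rw [coeff_proj, ite_ne_right_iff] at hu
  refine monomial_smul_mem_generatedInDegree (b := deg 0 k) (mem_gradedPiece.2
    ⟨R₀.range_aug.le ⟨_, rfl⟩, R₀.aug_mem k⟩) ?_ (hcd k u hu.2) _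
  rintro rfl
  exact hu.2 (hc k)

theorem proj_mem_generatedInDegree {N : Submodule (MvPolynomial (Fin n) K) (FreeMod K n m)}
    (hN : ∀ x ∈ N, ∀ W, proj (weightHom ω) (intWeight ε) W x ∈ N) {a : ℤ} {x : FreeMod K n m}
    (hx : x ∈ generatedInDegree d N a) (W : ℤ) :
    proj (weightHom ω) (intWeight ε) W x ∈ generatedInDegree d N a := by
  let U : Submodule K (FreeMod K n m) := ⨅ W,
    ((generatedInDegree d N a).restrictScalars K).comap (proj (weightHom ω) (intWeight ε) W)
  have hU : ∀ {x}, x ∈ U ↔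
      ∀ W, proj (weightHom ω) (intWeight ε) W x ∈ generatedInDegree d N a := by
    intro x
    simp [U, Submodule.mem_iInf]
  refine hU.1 (Submodule.span_induction (p := fun x _ => x ∈ U) ?_ U.zero_mem
      (fun x y _ _ hx hy => U.add_mem hx hy)
      (fun q x _ hx => smul_mem_of_monomial_smul_mem U ?_ q hx) hx) W
  · intro x hx
    exact hU.2 fun W => gradedPiece_subset_generatedInDegree (mem_gradedPiece.2
      ⟨hN x (mem_gradedPiece.1 hx).1 W, proj_mem_supportedOn (mem_gradedPiece.1 hx).2⟩)
  · intro u c x hx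
    refine hU.2 fun W => ?_
    rw [proj_monomial_smul]
    exact Submodule.smul_mem _ _ (hU.1 hx _)

/-- Weight components of a degree `a` element of the initial module are leading components of
elements that can be chosen in M_a. -/
theorem generatedInDegree_initialModule_le (hM : IsGraded d M) (a : ℤ) :
    generatedInDegree d (initialModule ω ε M) a ≤ initialModule ω ε (generatedInDegree d M a) := by
  refine Submodule.span_le.2 fun x hx => mem_initialModule.2 fun W => ?_
  obtain ⟨p, hp, hpW, hpx⟩ := exists_gradedPiece_proj_eq hM (mem_gradedPiece.1 hx).1
    (mem_gradedPiece.1 hx).2 W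
  exact ⟨p, gradedPiece_subset_generatedInDegree hp, hpW, hpx⟩

/-- Buchberger's criterion for `M_⟨a⟩`: as the syzygies of the degree `a` part of the initial
module are generated in degree at most `a + 1`, only the elements of `M_⟨a⟩` of degree at most
`a + 1` have to be considered. -/
theorem initialModule_generatedInDegree_eq (hM : IsGraded d M) {a : ℤ}
    (hreg : regularity d (generatedInDegree d (initialModule ω ε M) a) ≤
      ((a : WithTop ℤ) : WithBot (WithTop ℤ)))
    (hnext : ∀ g ∈ gradedPiece d (generatedInDegree d M a) (a + 1), ∀ W,
      g ∈ partLE K (weightHom ω) (intWeight ε) W → proj (weightHom ω) (intWeight ε) W g ∈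
        generatedInDegree d (initialModule ω ε M) a) :
    initialModule ω ε (generatedInDegree d M a) =
      generatedInDegree d (initialModule ω ε M) a := by
  refine le_antisymm ?_ (generatedInDegree_initialModule_le hM a)
  set N := generatedInDegree d (initialModule ω ε M) a with hN
  have hNin : initialModule ω ε N = N := initialModule_eq_self fun x hx W =>
    proj_mem_generatedInDegree (fun x hx W => proj_mem_of_mem_initialModule hx W) hx W
  -- `N` is its own initial module. The lifting theorem is used for its minimal resolution `R₀`,
  -- whose generators are homogeneous in both degree and weight.
  obtain ⟨rank, deg, R, R₀, hmin, hR₀⟩ :=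
    exists_lifted_resolution (M := N) ω ε (isGraded_generatedInDegree a)
  have hrange₀ : LinearMap.range R₀.aug = N := by rw [R₀.range_aug, hNin]
  have hdeg : ∀ i k, deg i k ≤ a + i := deg_le_of_regularity_le hmin (by rwa [hNin])
  have hN_mem : ∀ k, R₀.aug (Pi.single k 1) ∈ N := fun k => hrange₀.le ⟨_, rfl⟩
  have hne : ∀ k, R₀.aug (Pi.single k 1) ≠ 0 := fun k h => by
    simpa using hmin.constantCoeff_eq_zero (LinearMap.mem_ker.2 h) k
  -- The upper bound is the regularity; the lower one holds because `N` vanishes below degree `a`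
  -- and minimal generators are nonzero.
  have hdeg₀ : ∀ k, deg 0 k = a := by
    intro k
    refine le_antisymm (by simpa using hdeg 0 k) (not_lt.1 fun h => hne k ?_)
    exact eq_zero_of_mem_generatedInDegree_of_lt h
      (mem_gradedPiece.2 ⟨hN_mem k, R₀.aug_mem k⟩)
  let ε' : Fin (rank 0) → ℕ := fun k => maxWeight ω ε (R.aug (Pi.single k 1))
  have hwt₀ : ∀ k, R₀.aug (Pi.single k 1) ∈
      part K (weightHom ω) (intWeight ε) (intWeight ε' k) := fun k => by
    rw [hR₀, initialPart_eq_proj]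
    exact proj_mem_part _ _
  have hp : ∀ k, ∃ p ∈ gradedPiece d M a, p ∈ partLE K (weightHom ω) (intWeight ε)
      (intWeight ε' k) ∧ R₀.aug (Pi.single k 1) =
        proj (weightHom ω) (intWeight ε) (intWeight ε' k) p := by
    intro k
    have hk := R₀.aug_mem k
    rw [hdeg₀] at hk
    obtain ⟨p, hp, hpW, hpk⟩ := exists_gradedPiece_proj_eq hM
      (generatedInDegree_le a (hN_mem k)) hk (intWeight ε' k)
    exact ⟨p, hp, hpW, by rw [hpk, proj_eq_self (hwt₀ k)]⟩
  choose p hpM hpW hpk using hp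
  let φ := Fintype.linearCombination (MvPolynomial (Fin n) K) p
  have hφp : ∀ k, φ (Pi.single k 1) = p k := fun k => by
    rw [Fintype.linearCombination_apply_single, one_smul]
  have hφ : ∀ k, φ (Pi.single k 1) ∈ partLE K (weightHom ω) (intWeight ε) (intWeight ε' k) :=
    fun k => by rw [hφp]; exact hpW k
  have hφ₀ : ∀ k, R₀.aug (Pi.single k 1) =
      proj (weightHom ω) (intWeight ε) (intWeight ε' k) (φ (Pi.single k 1)) :=
    fun k => by rw [hφp]; exact hpk k
  have hφd : ∀ k, φ (Pi.single k 1) ∈ part K (degHom n) d (deg 0 k) := fun k => by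
    rw [hφp, hdeg₀]
    exact (mem_gradedPiece.1 (hpM k)).2
  have hφM : LinearMap.range φ ≤ generatedInDegree d M a := by
    rw [Fintype.range_linearCombination, Submodule.span_le]
    rintro _ ⟨k, rfl⟩
    exact gradedPiece_subset_generatedInDegree (hpM k)
  have hlead : ∀ b ≤ a + 1, ∀ g ∈ gradedPiece d (generatedInDegree d M a) b, ∀ W,
      g ∈ partLE K (weightHom ω) (intWeight ε) W →
      proj (weightHom ω) (intWeight ε) W g ∈ LinearMap.range R₀.aug := by
    intro b hb g hg W hgW
    rw [hrange₀]
    rcases lt_trichotomy b a with h | rfl | h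
    · rw [eq_zero_of_mem_generatedInDegree_of_lt h hg, map_zero]
      exact N.zero_mem
    · exact gradedPiece_subset_generatedInDegree (mem_gradedPiece.2 ⟨proj_mem_initialModule
        (generatedInDegree_le b (mem_gradedPiece.1 hg).1) hgW,
        proj_mem_supportedOn (mem_gradedPiece.1 hg).2⟩)
    · obtain rfl : b = a + 1 := by omega
      exact hnext g hg W hgW
  have hstd : ∀ b ≤ a + 1, ∀ g ∈ gradedPiece d (generatedInDegree d M a) b, ∀ W,
      g ∈ partLE K (weightHom ω) (intWeight ε) W →
      ∃ v ∈ partLE K (weightHom ω) (intWeight ε') W, φ v = g := by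
    intro b hb g hg W hgW
    obtain ⟨v, -, hv⟩ := exists_homogeneous_standard_representation hφ hφ₀ hφd hφM
      (hlead b hb) hg hgW
    exact ⟨v, hv⟩
  have hφrange : LinearMap.range φ = generatedInDegree d M a := by
    refine le_antisymm hφM (Submodule.span_le.2 fun g hg => ?_)
    obtain ⟨v, -, hv⟩ := hstd a (by omega) g (mem_gradedPiece.2
      ⟨gradedPiece_subset_generatedInDegree hg, (mem_gradedPiece.1 hg).2⟩) _
      (mem_partLE_maxWeight g)
    exact ⟨v, hv⟩
  -- The elements of which every weight component can be replaced by one of smaller weight with the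
  -- same image under `φ`. For syzygies of the leading parts this says that S-pairs reduce to zero.
  let Y : Submodule K (FreeMod K n (rank 0)) :=
    { carrier := {y | ∀ W, ∃ t ∈ partLE K (weightHom ω) (intWeight ε') (W - 1),
        φ t = φ (proj (weightHom ω) (intWeight ε') W y)}
      zero_mem' := fun W => ⟨0, Submodule.zero_mem _, by rw [map_zero (proj _ _ _)]⟩
      add_mem' := by
        intro x y hx hy W
        obtain ⟨s, hs, hsx⟩ := hx W
        obtain ⟨t, ht, hty⟩ := hy W
        exact ⟨s + t, Submodule.add_mem _ hs ht, by rw [map_add, map_add, map_add, hsx, hty]⟩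
      smul_mem' := by
        intro c x hx W
        obtain ⟨s, hs, hsx⟩ := hx W
        refine ⟨c • s, Submodule.smul_mem _ c hs, ?_⟩
        rw [map_smul (proj _ _ _), LinearMap.map_smul_of_tower φ, LinearMap.map_smul_of_tower φ, hsx] }
  have hY : ∀ y ∈ LinearMap.ker R₀.aug, y ∈ Y := by
    intro y hy
    rw [← R₀.range_diff_zero] at hy
    obtain ⟨q, rfl⟩ := hy
    refine linearMap_mem_of_monomial _ Y fun k u _ W => ?_
    set x := coeff u (q k)
    set s := proj (weightHom ω) (intWeight ε') (W - weightHom ω u) (R₀.diff 0 (Pi.single k 1))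
      with hs
    have hsW : s ∈ partLE K (weightHom ω) (intWeight ε') (W - weightHom ω u) :=
      part_le_partLE _ (proj_mem_part _ _)
    have hφs := map_mem_partLE (s := 0) (by simpa using hφ) hsW
    rw [add_zero] at hφs
    have hker : R₀.aug (R₀.diff 0 (Pi.single k 1)) = 0 :=
      LinearMap.mem_ker.1 (R₀.range_diff_zero.le ⟨_, rfl⟩)
    have hlow := mem_partLE_pred hφs (by
      rw [proj_map_of_partLE hφ hφ₀ hsW, hs, proj_proj, map_proj hwt₀, hker, map_zero])
    -- The bound `deg 1 k ≤ a + 1` given by the regularity is what makes `hstd` applicable.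
    obtain ⟨t, ht, hts⟩ := hstd (deg 1 k) (by simpa using hdeg 1 k) (φ s)
      (mem_gradedPiece.2 ⟨hφM ⟨_, rfl⟩,
        map_mem_part hφd (proj_mem_supportedOn (R₀.diff_mem 0 k))⟩) _ hlow
    refine ⟨monomial u x • t, ?_, ?_⟩
    · have := monomial_smul_mem_partLE ht u x
      rwa [show weightHom ω u + (W - weightHom ω u - 1) = W - 1 by ring] at this
    · rw [proj_monomial_smul, map_smul, map_smul, hts]
  -- Induction on the excess of the weight of `c` over that of `φ c`. While there is an excess, the
  -- top component of `c` is a syzygy of the leading parts and can be traded for lower weight by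
  -- `hY`; without excess, `R₀.aug` computes the leading component.
  have hclaim : ∀ (k : ℕ) (W W' : ℤ), W ≤ W' + k →
      ∀ c ∈ partLE K (weightHom ω) (intWeight ε') W,
      φ c ∈ partLE K (weightHom ω) (intWeight ε) W' →
      proj (weightHom ω) (intWeight ε) W' (φ c) ∈ N := by
    intro k
    induction k with
    | zero =>
      intro W W' hWW' c hc _
      rw [proj_map_of_partLE hφ hφ₀ (partLE_mono (by simpa using hWW') hc)]
      exact hrange₀.le ⟨_, rfl⟩
    | succ k ih =>
      intro W W' hWW' c hc hφc
      rcases le_or_gt W W' with h | h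
      · exact ih W W' (by omega) c hc hφc
      have hcW : proj (weightHom ω) (intWeight ε') W c ∈ LinearMap.ker R₀.aug := by
        rw [LinearMap.mem_ker, ← proj_map_of_partLE hφ hφ₀ hc, proj_eq_zero_of_lt hφc h]
      obtain ⟨t, ht, htc⟩ := hY _ hcW W
      rw [proj_proj] at htc
      have heq : φ (c - proj (weightHom ω) (intWeight ε') W c + t) = φ c := by
        rw [map_add, map_sub, htc, sub_add_cancel]
      have hlow : c - proj (weightHom ω) (intWeight ε') W c ∈
          partLE K (weightHom ω) (intWeight ε') (W - 1) :=
        mem_partLE_pred (Submodule.sub_mem _ hc (part_le_partLE _ (proj_mem_part _ _)))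
          (by rw [map_sub, proj_proj, sub_self])
      rw [← heq] at hφc ⊢
      exact ih (W - 1) W' (by push_cast at hWW'; omega) _ (Submodule.add_mem _ hlow ht) hφc
  refine Submodule.span_le.2 ?_
  rintro _ ⟨f, hf, rfl⟩
  obtain ⟨c, rfl⟩ := hφrange.ge hf
  rw [initialPart_eq_proj]
  exact hclaim (maxWeight ω ε' c) (maxWeight ω ε' c) _ (by omega) c (mem_partLE_maxWeight c)
    (mem_partLE_maxWeight _)

end ComponentwiseLinear

end GradedFree

/-! ### The main theorem -/

theorem corollary5p5 {K : Type*} [Field K] {n m : ℕ}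
    (ω : Fin n → ℕ) (d : Fin m → ℤ) (ε : Fin m → ℕ)
    (M : Submodule (MvPolynomial (Fin n) K) (GradedFree.FreeMod K n m))
    (hM : GradedFree.IsGraded d M)
    (hin : GradedFree.IsComponentwiseLinear d (GradedFree.initialModule ω ε M))
    (hbetti : GradedFree.betti d M 1 = GradedFree.betti d (GradedFree.initialModule ω ε M) 1) :
    GradedFree.IsComponentwiseLinear d M := by
  intro a
  have hreg := hin a
  rw [add_zero] at hreg ⊢
  obtain ⟨S⟩ := GradedFree.nonempty_minimalResolution hM
  have hS := S.isMinimal_toGradedResolution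
  obtain ⟨rank, deg, R, R₀, hR₀, haug⟩ := GradedFree.exists_lifted_resolution ω ε hM
  rw [GradedFree.betti_eq_rank hS, GradedFree.betti_eq_rank hR₀] at hbetti
  -- This kernel is the image of the first differential of `R`, whose source has rank β_1(in(M));
  -- the equality of first Betti numbers makes that differential minimal.
  have hker : ∀ c ∈ LinearMap.ker R.aug, ∀ k, MvPolynomial.constantCoeff (c k) = 0 := by
    intro c hc k
    rw [← R.range_diff_zero] at hc
    obtain ⟨x, rfl⟩ := hc
    exact hS.constantCoeff_diff_eq_zero R hbetti x k
  have heq := GradedFree.initialModule_generatedInDegree_eq hM hreg fun g hg W hgW =>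
    GradedFree.proj_mem_generatedInDegree_initialModule R R₀ haug hker hg hgW
  -- `Q` resolves M_⟨a⟩ with the degrees of the minimal resolution `Q₀` of its initial module, which
  -- by `heq` has regularity at most `a`.
  obtain ⟨rank', deg', Q, Q₀, hQ₀, -⟩ := GradedFree.exists_lifted_resolution ω ε
    (GradedFree.isGraded_generatedInDegree (d := d) (M := M) a)
  exact GradedFree.regularity_le_of_deg_le Q
    (GradedFree.deg_le_of_regularity_le hQ₀ (by rwa [heq]))
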